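/- Let $n\ge 1$ and let $l_1,\dots,l_{n+1}$ be a generic family of linear forms on $\mathbf C^n$, that is, every subfamily of $n$ of these forms has rank $n$. Let $\mathcal D_{\mathbf C^n}[s_1,\dots,s_{n+1}]$ be the sheaf of differential operators on $\mathbf C^n$ with coefficients in $\mathcal O_{\mathbf C^n}[s_1,\dots,s_{n+1}]$, where $\mathcal O_{\mathbf C^n}$ is the sheaf of holomorphic functions. It acts in the natural way on $\mathcal O_{\mathbf C^n}\big[s_1,\dots,s_{n+1},\tfrac1{l_1\cdots l_{n+1}}\big]\,l_1^{s_1}\cdots l_{n+1}^{s_{n+1}}$, namely $$\frac{\partial}{\partial x_m}\big(g\, l_1^{s_1}\cdots l_{n+1}^{s_{n+1}}\big)=\Big(\frac{\partial g}{\partial x_m}+g\sum_{k=1}^{n+1}\frac{s_k}{l_k}\frac{\partial l_k}{\partial x_m}\Big)l_1^{s_1}\cdots l_{n+1}^{s_{n+1}} .$$ Let $\mathrm{Ann}(l_1^{s_1}\cdots l_{n+1}^{s_{n+1}})$ be the left ideal of $\mathcal D_{\mathbf C^n}[s_1,\dots,s_{n+1}]$ formed by the operators $P$ with $P(l_1^{s_1}\cdots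 l_{n+1}^{s_{n+1}})=0$. For distinct $i,j\in\{1,\dots,n+1\}$ let $U_{i,j}$ be the unique constant vector field on $\mathbf C^n$ with $U_{i,j}(l_i)=1$ and $U_{i,j}(l_k)=0$ for all $k\ne i,j$, and put $$\tilde U_{i,j}=l_il_jU_{i,j}-l_js_i-U_{i,j}(l_j)\,l_is_j,\qquad \tilde E=\sum_{m=1}^n x_m\frac{\partial}{\partial x_m}-s_1-\cdots-s_{n+1}.$$ Then $\mathrm{Ann}(l_1^{s_1}\cdots l_{n+1}^{s_{n+1}})$ is the left ideal generated by $\tilde E$ and the operators $\tilde U_{i,j}$ for $2\le i<j\le n+1$; that is, for every $x_0\in\mathbf C^n$ this equality of left ideals holds in the stalk $\mathcal D_{\mathbf C^n,x_0}[s_1,\dots,s_{n+1}]$. -/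

import Mathlib

open scoped Topology

noncomputable section

namespace HyperplaneAnn

/-! ### Generic families of `n + 1` linear forms on `ℂⁿ` -/

section LinearForms

variable {n : ℕ}

/-- Every subfamily of `n` elements of the family `l` of linear forms on `ℂⁿ` has rank `n`. -/
def Generic {p : ℕ} (l : Fin p → Module.Dual ℂ (Fin n → ℂ)) : Prop :=
  ∀ S : Finset (Fin p), S.card = n →
    Module.finrank ℂ (Submodule.span ℂ (l '' (S : Set (Fin p)))) = n

theorem Generic.existsUnique {l : Fin (n + 1) → Module.Dual ℂ (Fin n → ℂ)} (hl : Generic l)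
    {i j : Fin (n + 1)} (hij : i ≠ j) :
    ∃! u : Fin n → ℂ, l i u = 1 ∧ ∀ k, k ≠ i → k ≠ j → l k u = 0 := by
  classical
  set S : Finset (Fin (n + 1)) := Finset.univ.erase j with hS
  have hcard : S.card = n := by simp [hS]
  have hspan : Submodule.span ℂ (l '' (S : Set (Fin (n + 1)))) = ⊤ := by
    apply Submodule.eq_top_of_finrank_eq
    rw [hl S hcard, Subspace.dual_finrank_eq, Module.finrank_fin_fun]
  let T : (Fin n → ℂ) →ₗ[ℂ] (S → ℂ) := LinearMap.pi fun k => l k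
  have hinj : Function.Injective T := by
    rw [← LinearMap.ker_eq_bot, LinearMap.ker_eq_bot']
    intro v hv
    have h0 : ∀ φ : Module.Dual ℂ (Fin n → ℂ), φ v = 0 := by
      intro φ
      have hφ : φ ∈ Submodule.span ℂ (l '' (S : Set (Fin (n + 1)))) := by rw [hspan]; trivial
      induction hφ using Submodule.span_induction with
      | mem x hx =>
        obtain ⟨k, hk, rfl⟩ := hx
        exact congrFun hv ⟨k, hk⟩
      | zero => simp
      | add x y _ _ hx hy => simp [hx, hy]
      | smul c x _ hx => simp [hx]
    exact (Module.forall_dual_apply_eq_zero_iff ℂ v).1 h0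
  have hsurj : Function.Surjective T := by
    apply (LinearMap.injective_iff_surjective_of_finrank_eq_finrank _).1 hinj
    simp [hcard]
  have hmem : ∀ k, k ≠ j → k ∈ S := fun k hk => by simp [hS, hk]
  obtain ⟨u, hu⟩ := hsurj (Pi.single ⟨i, hmem i hij⟩ 1)
  refine ⟨u, ⟨?_, ?_⟩, ?_⟩
  · have := congrFun hu ⟨i, hmem i hij⟩
    simpa [T] using this
  · intro k hki hkj
    have := congrFun hu ⟨k, hmem k hkj⟩
    have hne : (⟨k, hmem k hkj⟩ : S) ≠ ⟨i, hmem i hij⟩ := by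
      intro h; exact hki (congrArg Subtype.val h)
    simpa [T, hne] using this
  · rintro w ⟨hw1, hw2⟩
    apply hinj
    rw [hu]
    funext ⟨k, hk⟩
    by_cases hki : k = i
    · subst hki; simpa [T] using hw1
    · have hne : (⟨k, hk⟩ : S) ≠ ⟨i, hmem i hij⟩ := by
        intro h; exact hki (congrArg Subtype.val h)
      have hkj : k ≠ j := by simpa [hS] using hk
      simpa [T, hne] using hw2 k hki hkj

/-- The unique constant vector field `U_{i,j}` with `U_{i,j}(l_i) = 1` and
`U_{i,j}(l_k) = 0` for `k ≠ i, j`, as a vector of `ℂⁿ`. -/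
def constField {l : Fin (n + 1) → Module.Dual ℂ (Fin n → ℂ)} (hl : Generic l)
    {i j : Fin (n + 1)} (hij : i ≠ j) : Fin n → ℂ :=
  (hl.existsUnique hij).choose

end LinearForms

/-! ### Germs of holomorphic functions on `ℂⁿ` -/

section Germs

variable {n : ℕ} (x₀ : Fin n → ℂ)

/-- Functions which are analytic in a neighbourhood of `x₀`. -/
def analyticAt : Subalgebra ℂ ((Fin n → ℂ) → ℂ) where
  carrier := {f | AnalyticAt ℂ f x₀}
  mul_mem' hf hg := AnalyticAt.mul hf hg
  add_mem' hf hg := AnalyticAt.add hf hg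
  algebraMap_mem' _ := analyticAt_const

/-- Functions whose germ at `x₀` is zero. -/
def germZero : Ideal (analyticAt x₀) where
  carrier := {f | ∀ᶠ x in 𝓝 x₀, f.1 x = 0}
  add_mem' {f g} hf hg := by
    filter_upwards [hf, hg] with x hx hy
    change f.1 x + g.1 x = 0
    rw [hx, hy, add_zero]
  zero_mem' := Filter.Eventually.of_forall fun _ => rfl
  smul_mem' c f hf := by
    filter_upwards [hf] with x hx
    change c.1 x * f.1 x = 0
    rw [hx, mul_zero]

/-- The ring `𝒪_{ℂⁿ, x₀}` of germs at `x₀` of holomorphic functions. -/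
def Stalk : Type := analyticAt x₀ ⧸ germZero x₀

instance : CommRing (Stalk x₀) := inferInstanceAs (CommRing (analyticAt x₀ ⧸ germZero x₀))

instance : Algebra ℂ (Stalk x₀) := inferInstanceAs (Algebra ℂ (analyticAt x₀ ⧸ germZero x₀))

/-- The germ at `x₀` of a function which is analytic at `x₀`. -/
def germ {x₀ : Fin n → ℂ} (f : (Fin n → ℂ) → ℂ) (hf : AnalyticAt ℂ f x₀) : Stalk x₀ :=
  Ideal.Quotient.mk (germZero x₀) ⟨f, hf⟩

variable {x₀}

theorem germ_eq_iff {f g : (Fin n → ℂ) → ℂ} {hf : AnalyticAt ℂ f x₀} {hg : AnalyticAt ℂ g x₀} :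
    germ f hf = germ g hg ↔ ∀ᶠ x in 𝓝 x₀, f x = g x := by
  refine Ideal.Quotient.eq.trans ?_
  change (∀ᶠ x in 𝓝 x₀, f x - g x = 0) ↔ _
  simp only [sub_eq_zero]

theorem exists_germ (a : Stalk x₀) : ∃ f hf, a = germ (x₀ := x₀) f hf := by
  obtain ⟨⟨f, hf⟩, rfl⟩ := Ideal.Quotient.mk_surjective a
  exact ⟨f, hf, rfl⟩

theorem analyticAt_dirDeriv (v : Fin n → ℂ) {f : (Fin n → ℂ) → ℂ} (hf : AnalyticAt ℂ f x₀) :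
    AnalyticAt ℂ (fun x => fderiv ℂ f x v) x₀ :=
  ((ContinuousLinearMap.apply ℂ ℂ v).analyticAt _).comp hf.fderiv

/-- The function underlying the directional derivative `germ f ↦ germ (x ↦ df_x(v))`. -/
def dirDerivFun (v : Fin n → ℂ) (a : Stalk x₀) : Stalk x₀ :=
  germ (fun x => fderiv ℂ (exists_germ a).choose x v)
    (analyticAt_dirDeriv v (exists_germ a).choose_spec.choose)

theorem dirDerivFun_germ (v : Fin n → ℂ) {f : (Fin n → ℂ) → ℂ} (hf : AnalyticAt ℂ f x₀) :
    dirDerivFun v (germ f hf) = germ (fun x => fderiv ℂ f x v) (analyticAt_dirDeriv v hf) := by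
  unfold dirDerivFun
  rw [germ_eq_iff]
  have h := (exists_germ (germ f hf)).choose_spec.choose_spec
  rw [germ_eq_iff] at h
  filter_upwards [h.eventually_nhds] with x hx
  have : f =ᶠ[𝓝 x] (exists_germ (germ f hf)).choose := hx
  rw [this.fderiv_eq]

/-- The derivation of `𝒪_{ℂⁿ, x₀}` given by the constant vector field `v`. -/
def dirDeriv (x₀ : Fin n → ℂ) (v : Fin n → ℂ) : Derivation ℂ (Stalk x₀) (Stalk x₀) :=
  Derivation.mk'
    { toFun := dirDerivFun v
      map_add' := by
        intro a b
        obtain ⟨f, hf, rfl⟩ := exists_germ a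
        obtain ⟨g, hg, rfl⟩ := exists_germ b
        have e : germ f hf + germ g hg = germ (fun x => f x + g x) (hf.add hg) := rfl
        rw [e, dirDerivFun_germ, dirDerivFun_germ, dirDerivFun_germ]
        change _ = germ (fun x => fderiv ℂ f x v + fderiv ℂ g x v)
          ((analyticAt_dirDeriv v hf).add (analyticAt_dirDeriv v hg))
        rw [germ_eq_iff]
        filter_upwards [hf.eventually_analyticAt, hg.eventually_analyticAt] with x hx hy
        rw [fderiv_fun_add hx.differentiableAt hy.differentiableAt]
        rfl
      map_smul' := by
        intro c a
        obtain ⟨f, hf, rfl⟩ := exists_germ a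
        have e : c • germ f hf = germ (fun x => c * f x) (analyticAt_const.mul hf) := rfl
        rw [e, dirDerivFun_germ, dirDerivFun_germ]
        change _ = germ (fun x => c * fderiv ℂ f x v)
          (analyticAt_const.mul (analyticAt_dirDeriv v hf))
        rw [germ_eq_iff]
        filter_upwards [hf.eventually_analyticAt] with x hx
        rw [fderiv_const_mul hx.differentiableAt]
        rfl }
    (by
      intro a b
      obtain ⟨f, hf, rfl⟩ := exists_germ a
      obtain ⟨g, hg, rfl⟩ := exists_germ b
      change dirDerivFun v (germ f hf * germ g hg) =
        germ f hf * dirDerivFun v (germ g hg) + germ g hg * dirDerivFun v (germ f hf)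
      have e : germ f hf * germ g hg = germ (fun x => f x * g x) (hf.mul hg) := rfl
      rw [e, dirDerivFun_germ, dirDerivFun_germ, dirDerivFun_germ]
      change _ = germ (fun x => f x * fderiv ℂ g x v + g x * fderiv ℂ f x v)
        ((hf.mul (analyticAt_dirDeriv v hg)).add (hg.mul (analyticAt_dirDeriv v hf)))
      rw [germ_eq_iff]
      filter_upwards [hf.eventually_analyticAt, hg.eventually_analyticAt] with x hx hy
      rw [fderiv_fun_mul hx.differentiableAt hy.differentiableAt]
      rfl)

theorem dirDeriv_germ (v : Fin n → ℂ) {f : (Fin n → ℂ) → ℂ} (hf : AnalyticAt ℂ f x₀) :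
    dirDeriv x₀ v (germ f hf) = germ (fun x => fderiv ℂ f x v) (analyticAt_dirDeriv v hf) :=
  dirDerivFun_germ v hf

theorem dirDeriv_comm (v w : Fin n → ℂ) (a : Stalk x₀) :
    dirDeriv x₀ v (dirDeriv x₀ w a) = dirDeriv x₀ w (dirDeriv x₀ v a) := by
  obtain ⟨f, hf, rfl⟩ := exists_germ a
  simp only [dirDeriv_germ]
  rw [germ_eq_iff]
  filter_upwards [hf.eventually_analyticAt] with x hx
  have hd : DifferentiableAt ℂ (fderiv ℂ f) x := hx.fderiv.differentiableAt
  have key : ∀ u t : Fin n → ℂ,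
      fderiv ℂ (fun y => fderiv ℂ f y u) x t = fderiv ℂ (fderiv ℂ f) x t u := by
    intro u t
    rw [fderiv_clm_apply hd (differentiableAt_const u)]
    simp
  rw [key, key]
  exact (hx.contDiffAt (n := ⊤)).isSymmSndFDerivAt (by simp) v w

/-- The partial derivative `∂/∂x_m` on `𝒪_{ℂⁿ, x₀}`. -/
def partialDeriv (x₀ : Fin n → ℂ) (m : Fin n) : Derivation ℂ (Stalk x₀) (Stalk x₀) :=
  dirDeriv x₀ (Pi.single m 1)

theorem analyticAt_linearForm (x₀ : Fin n → ℂ) (φ : Module.Dual ℂ (Fin n → ℂ)) :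
    AnalyticAt ℂ (fun x => φ x) x₀ :=
  (LinearMap.toContinuousLinearMap φ).analyticAt x₀

/-- The germ at `x₀` of a linear form on `ℂⁿ`. -/
def linGerm (x₀ : Fin n → ℂ) (φ : Module.Dual ℂ (Fin n → ℂ)) : Stalk x₀ :=
  germ (fun x => φ x) (analyticAt_linearForm x₀ φ)

end Germs

/-! ### Extension of derivations to polynomial rings and to localizations -/

section Derivations

open TrivSqZeroExt

variable {R : Type} [CommRing R] [Algebra ℂ R]

/-- The derivation `x ↦ D x` given by a ring homomorphism `x ↦ x + ε D x` to the dual numbers. -/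
def derOfHom {A : Type} [CommRing A] [Algebra ℂ A] (Φ : A →+* TrivSqZeroExt A A)
    (hfst : ∀ x, (Φ x).fst = x) (hℂ : ∀ c : ℂ, (Φ (algebraMap ℂ A c)).snd = 0) :
    Derivation ℂ A A :=
  Derivation.mk'
    { toFun := fun x => (Φ x).snd
      map_add' := fun x y => by rw [map_add, snd_add]
      map_smul' := fun c x => by
        rw [Algebra.smul_def, map_mul, snd_mul, hℂ, hfst, smul_zero, add_zero, smul_eq_mul,
          RingHom.id_apply, Algebra.smul_def] }
    (fun x y => by
      change (Φ (x * y)).snd = x • (Φ y).snd + y • (Φ x).snd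
      rw [map_mul, snd_mul, hfst, hfst, op_smul_eq_smul])

/-- The ring homomorphism `a ↦ a + ε d a` from `R` to the dual numbers over an `R`-algebra. -/
def dualHom (A : Type) [CommRing A] [Algebra R A] (d : Derivation ℂ R R) :
    R →+* TrivSqZeroExt A A where
  toFun a := inl (algebraMap R A a) + inr (algebraMap R A (d a))
  map_one' := by rw [map_one, d.map_one_eq_zero, map_zero, inr_zero, add_zero, inl_one]
  map_mul' a b := by
    apply TrivSqZeroExt.ext
    · simp only [fst_add, fst_mul, fst_inl, fst_inr, add_zero, map_mul]
    · simp only [snd_add, snd_mul, fst_add, snd_inl, snd_inr, fst_inl, fst_inr, zero_add,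
        add_zero, d.leibniz, map_add, smul_eq_mul, map_mul, op_smul_eq_smul]
  map_zero' := by rw [map_zero, map_zero, map_zero, inl_zero, inr_zero, add_zero]
  map_add' a b := by
    rw [map_add, map_add, map_add, inl_add, inr_add, add_add_add_comm]

theorem fst_dualHom (A : Type) [CommRing A] [Algebra R A] (d : Derivation ℂ R R) (a : R) :
    (dualHom A d a).fst = algebraMap R A a := by
  change (inl (algebraMap R A a) + inr (algebraMap R A (d a))).fst = _
  rw [fst_add, fst_inl, fst_inr, add_zero]

theorem snd_dualHom (A : Type) [CommRing A] [Algebra R A] (d : Derivation ℂ R R) (a : R) :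
    (dualHom A d a).snd = algebraMap R A (d a) := by
  change (inl (algebraMap R A a) + inr (algebraMap R A (d a))).snd = _
  rw [snd_add, snd_inl, snd_inr, zero_add]

/-- The homomorphism `x ↦ x + ε D x` for the extension `D` of `d` to `R[s]` which is zero on the
variables. -/
def polyHom (σ : Type) (d : Derivation ℂ R R) :
    MvPolynomial σ R →+* TrivSqZeroExt (MvPolynomial σ R) (MvPolynomial σ R) :=
  MvPolynomial.eval₂Hom (dualHom _ d) fun k => inl (MvPolynomial.X k)

theorem polyHom_C (σ : Type) (d : Derivation ℂ R R) (a : R) :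
    polyHom σ d (MvPolynomial.C a) = dualHom _ d a := MvPolynomial.eval₂Hom_C _ _ _

theorem polyHom_X (σ : Type) (d : Derivation ℂ R R) (k : σ) :
    polyHom σ d (MvPolynomial.X k) = inl (MvPolynomial.X k) := MvPolynomial.eval₂Hom_X' _ _ _

/-- The extension of a derivation `d` of `R` to `R[s]` which is zero on the variables. -/
def polyDer {σ : Type} (d : Derivation ℂ R R) :
    Derivation ℂ (MvPolynomial σ R) (MvPolynomial σ R) :=
  derOfHom (polyHom σ d)
    (fun p => by
      induction p using MvPolynomial.induction_on with
      | C a => rw [polyHom_C, fst_dualHom]; rfl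
      | add p q hp hq => rw [map_add, fst_add, hp, hq]
      | mul_X p k hp => rw [map_mul, fst_mul, hp, polyHom_X, fst_inl])
    (fun c => by
      change (polyHom σ d (MvPolynomial.C (algebraMap ℂ R c))).snd = 0
      rw [polyHom_C, snd_dualHom, d.map_algebraMap, map_zero])

theorem polyDer_C {σ : Type} (d : Derivation ℂ R R) (a : R) :
    polyDer (σ := σ) d (MvPolynomial.C a) = MvPolynomial.C (d a) := by
  change (polyHom σ d (MvPolynomial.C a)).snd = _
  rw [polyHom_C, snd_dualHom]; rfl

theorem polyDer_X {σ : Type} (d : Derivation ℂ R R) (k : σ) :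
    polyDer d (MvPolynomial.X k) = 0 := by
  change (polyHom σ d (MvPolynomial.X k)).snd = _
  rw [polyHom_X, snd_inl]

theorem polyDer_comm {σ : Type} {d e : Derivation ℂ R R} (h : ∀ a, d (e a) = e (d a))
    (p : MvPolynomial σ R) : polyDer d (polyDer e p) = polyDer e (polyDer d p) := by
  induction p using MvPolynomial.induction_on with
  | C a => simp only [polyDer_C, h]
  | add p q hp hq => simp only [map_add, hp, hq]
  | mul_X p k hp =>
    simp only [Derivation.leibniz, polyDer_X, mul_zero, zero_add, smul_eq_mul, hp]

/-- The homomorphism `x ↦ x + ε D x` for the extension `D` of `d` to `R[1/h]`. -/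
def locHom (h : R) (d : Derivation ℂ R R) :
    Localization.Away h →+* TrivSqZeroExt (Localization.Away h) (Localization.Away h) :=
  IsLocalization.Away.lift (g := dualHom (Localization.Away h) d) h (by
    rw [isUnit_iff_isUnit_fst, fst_dualHom]
    exact IsLocalization.Away.algebraMap_isUnit h)

theorem locHom_algebraMap (h : R) (d : Derivation ℂ R R) (a : R) :
    locHom h d (algebraMap R (Localization.Away h) a) = dualHom _ d a :=
  IsLocalization.Away.lift_eq h _ a

theorem fst_locHom (h : R) (d : Derivation ℂ R R) (x : Localization.Away h) :
    (locHom h d x).fst = x := by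
  have : (fstHom ℂ (Localization.Away h) (Localization.Away h)).toRingHom.comp (locHom h d) =
      RingHom.id (Localization.Away h) := by
    apply IsLocalization.ringHom_ext (Submonoid.powers h)
    apply RingHom.ext
    intro a
    change (locHom h d (algebraMap R (Localization.Away h) a)).fst = algebraMap R _ a
    rw [locHom_algebraMap, fst_dualHom]
  exact RingHom.congr_fun this x

/-- The extension of a derivation `d` of `R` to the localization `R[1/h]`. -/
def locDer (h : R) (d : Derivation ℂ R R) :
    Derivation ℂ (Localization.Away h) (Localization.Away h) :=
  derOfHom (locHom h d) (fst_locHom h d) (fun c => by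
    rw [IsScalarTower.algebraMap_apply ℂ R (Localization.Away h), locHom_algebraMap, snd_dualHom,
      d.map_algebraMap, map_zero])

theorem locDer_algebraMap (h : R) (d : Derivation ℂ R R) (a : R) :
    locDer h d (algebraMap R (Localization.Away h) a) =
      algebraMap R (Localization.Away h) (d a) := by
  change (locHom h d (algebraMap R (Localization.Away h) a)).snd = _
  rw [locHom_algebraMap, snd_dualHom]

theorem locDer_comm (h : R) {d e : Derivation ℂ R R} (hde : ∀ a, d (e a) = e (d a))
    (x : Localization.Away h) : locDer h d (locDer h e x) = locDer h e (locDer h d x) := by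
  have hB : ∀ a : R, ⁅locDer h d, locDer h e⁆ (algebraMap R (Localization.Away h) a) = 0 := by
    intro a
    rw [Derivation.commutator_apply, locDer_algebraMap, locDer_algebraMap, locDer_algebraMap,
      locDer_algebraMap, hde, sub_self]
  obtain ⟨k, a, hka⟩ := IsLocalization.Away.surj (S := Localization.Away h) h x
  have hk : IsUnit (algebraMap R (Localization.Away h) h ^ k) :=
    (IsLocalization.Away.algebraMap_isUnit h).pow k
  have h1 : ⁅locDer h d, locDer h e⁆ (x * algebraMap R (Localization.Away h) h ^ k) = 0 := by
    rw [hka, hB]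
  rw [← map_pow, Derivation.leibniz, hB, smul_zero, zero_add, smul_eq_mul, map_pow,
    hk.mul_right_eq_zero, Derivation.commutator_apply, sub_eq_zero] at h1
  exact h1

end Derivations

/-! ### Rings of differential operators and their action on `R[1/f₁⋯f_p] · f₁^{s₁}⋯f_p^{s_p}` -/

section Operators

variable {R : Type} [CommRing R] [Algebra ℂ R] {n : ℕ}

/-- The relations of a ring of differential operators with coefficients in `R`:
`R` is a subalgebra, `∂_i a = a ∂_i + δ_i(a)` and `∂_i ∂_j = ∂_j ∂_i`. -/
inductive DiffOpRel (δ : Fin n → Derivation ℂ R R) :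
    FreeAlgebra ℂ (R ⊕ Fin n) → FreeAlgebra ℂ (R ⊕ Fin n) → Prop
  | add (a b : R) : DiffOpRel δ (FreeAlgebra.ι ℂ (Sum.inl (a + b)))
      (FreeAlgebra.ι ℂ (Sum.inl a) + FreeAlgebra.ι ℂ (Sum.inl b))
  | mul (a b : R) : DiffOpRel δ (FreeAlgebra.ι ℂ (Sum.inl (a * b)))
      (FreeAlgebra.ι ℂ (Sum.inl a) * FreeAlgebra.ι ℂ (Sum.inl b))
  | scalar (c : ℂ) : DiffOpRel δ (FreeAlgebra.ι ℂ (Sum.inl (algebraMap ℂ R c)))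
      (algebraMap ℂ _ c)
  | leibniz (i : Fin n) (a : R) :
      DiffOpRel δ (FreeAlgebra.ι ℂ (Sum.inr i) * FreeAlgebra.ι ℂ (Sum.inl a))
        (FreeAlgebra.ι ℂ (Sum.inl a) * FreeAlgebra.ι ℂ (Sum.inr i) +
          FreeAlgebra.ι ℂ (Sum.inl (δ i a)))
  | comm (i j : Fin n) :
      DiffOpRel δ (FreeAlgebra.ι ℂ (Sum.inr i) * FreeAlgebra.ι ℂ (Sum.inr j))
        (FreeAlgebra.ι ℂ (Sum.inr j) * FreeAlgebra.ι ℂ (Sum.inr i))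

/-- The ring `R⟨∂_1, …, ∂_n⟩` of differential operators with coefficients in `R`, where
`∂_i` acts on `R` as the derivation `δ_i`. -/
def DiffOp (δ : Fin n → Derivation ℂ R R) : Type := RingQuot (DiffOpRel δ)

instance (δ : Fin n → Derivation ℂ R R) : Ring (DiffOp δ) :=
  inferInstanceAs (Ring (RingQuot (DiffOpRel δ)))

instance (δ : Fin n → Derivation ℂ R R) : Algebra ℂ (DiffOp δ) :=
  inferInstanceAs (Algebra ℂ (RingQuot (DiffOpRel δ)))

namespace DiffOp

/-- The canonical map from the free algebra. -/
def mk (δ : Fin n → Derivation ℂ R R) : FreeAlgebra ℂ (R ⊕ Fin n) →ₐ[ℂ] DiffOp δ :=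
  RingQuot.mkAlgHom ℂ (DiffOpRel δ)

theorem mk_rel {δ : Fin n → Derivation ℂ R R} {x y : FreeAlgebra ℂ (R ⊕ Fin n)}
    (h : DiffOpRel δ x y) : mk δ x = mk δ y :=
  RingQuot.mkAlgHom_rel ℂ h

/-- Elements of `R` as differential operators of order zero. -/
def coeff (δ : Fin n → Derivation ℂ R R) : R →ₐ[ℂ] DiffOp δ :=
  AlgHom.ofLinearMap
    { toFun := fun a => mk δ (FreeAlgebra.ι ℂ (Sum.inl a))
      map_add' := fun a b => by rw [mk_rel (.add a b), map_add]
      map_smul' := fun c a => by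
        rw [Algebra.smul_def, mk_rel (.mul _ a), map_mul, mk_rel (.scalar c), AlgHom.commutes,
          RingHom.id_apply, Algebra.smul_def] }
    (by
      change mk δ (FreeAlgebra.ι ℂ (Sum.inl 1)) = 1
      rw [← map_one (algebraMap ℂ R), mk_rel (.scalar 1), map_one, map_one])
    (fun a b => by
      change mk δ (FreeAlgebra.ι ℂ (Sum.inl (a * b))) = _
      rw [mk_rel (.mul a b), map_mul]; rfl)

/-- The operator `∂_i`. -/
def der (δ : Fin n → Derivation ℂ R R) (i : Fin n) : DiffOp δ :=
  mk δ (FreeAlgebra.ι ℂ (Sum.inr i))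

/-- An algebra homomorphism out of `DiffOp δ` is a representation of `R` and of the `∂_i`
satisfying the defining relations. -/
def lift {δ : Fin n → Derivation ℂ R R} {B : Type} [Ring B] [Algebra ℂ B] (φ : R →ₐ[ℂ] B)
    (D : Fin n → B) (h₁ : ∀ i a, D i * φ a = φ a * D i + φ (δ i a))
    (h₂ : ∀ i j, D i * D j = D j * D i) : DiffOp δ →ₐ[ℂ] B :=
  RingQuot.liftAlgHom ℂ ⟨FreeAlgebra.lift ℂ (Sum.elim φ D), by
    intro x y h
    cases h with
    | add a b => simp
    | mul a b => simp
    | scalar c => simp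
    | leibniz i a => simp [h₁]
    | comm i j => simp [h₂ i j]⟩

theorem lift_coeff {δ : Fin n → Derivation ℂ R R} {B : Type} [Ring B] [Algebra ℂ B]
    (φ : R →ₐ[ℂ] B) (D : Fin n → B) (h₁ : ∀ i a, D i * φ a = φ a * D i + φ (δ i a))
    (h₂ : ∀ i j, D i * D j = D j * D i) (a : R) : lift φ D h₁ h₂ (coeff δ a) = φ a := by
  change RingQuot.liftAlgHom ℂ _ (RingQuot.mkAlgHom ℂ (DiffOpRel δ) _) = _
  rw [RingQuot.liftAlgHom_mkAlgHom_apply]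
  simp

theorem lift_der {δ : Fin n → Derivation ℂ R R} {B : Type} [Ring B] [Algebra ℂ B]
    (φ : R →ₐ[ℂ] B) (D : Fin n → B) (h₁ : ∀ i a, D i * φ a = φ a * D i + φ (δ i a))
    (h₂ : ∀ i j, D i * D j = D j * D i) (i : Fin n) : lift φ D h₁ h₂ (der δ i) = D i := by
  change RingQuot.liftAlgHom ℂ _ (RingQuot.mkAlgHom ℂ (DiffOpRel δ) _) = _
  rw [RingQuot.liftAlgHom_mkAlgHom_apply]
  simp

end DiffOp

variable {p : ℕ} (f s : Fin p → R)

/-- The module `R[1/(f₁⋯f_p)]`, whose element `g` stands for the symbol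
`g · f₁^{s₁}⋯f_p^{s_p}`. -/
abbrev PowModule : Type := Localization.Away (∏ k, f k)

/-- The inverse of `f_k` in `R[1/(f₁⋯f_p)]`. -/
def invFactor (k : Fin p) : PowModule f :=
  algebraMap R _ (∏ m ∈ Finset.univ.erase k, f m) * IsLocalization.Away.invSelf (∏ m, f m)

set_option linter.unusedSectionVars false in
theorem mul_invFactor (k : Fin p) : algebraMap R (PowModule f) (f k) * invFactor f k = 1 := by
  unfold invFactor
  rw [← mul_assoc, ← map_mul, Finset.mul_prod_erase _ _ (Finset.mem_univ k),
    IsLocalization.Away.mul_invSelf]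

/-- The logarithmic derivative `∑_k s_k δ(f_k) / f_k` of the symbol `f₁^{s₁}⋯f_p^{s_p}`. -/
def logDer (d : Derivation ℂ R R) : PowModule f :=
  ∑ k, algebraMap R _ (s k * d (f k)) * invFactor f k

theorem locDer_invFactor (d : Derivation ℂ R R) (k : Fin p) :
    locDer (∏ k, f k) d (invFactor f k) =
      -(invFactor f k ^ 2 * algebraMap R _ (d (f k))) := by
  have h : invFactor f k * algebraMap R (PowModule f) (f k) = 1 := by
    rw [mul_comm, mul_invFactor]
  rw [Derivation.leibniz_of_mul_eq_one _ h, locDer_algebraMap, smul_eq_mul, neg_mul]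

theorem locDer_logDer {d e : Derivation ℂ R R} (hde : ∀ a, d (e a) = e (d a))
    (hd : ∀ k, d (s k) = 0) (he : ∀ k, e (s k) = 0) :
    locDer (∏ k, f k) d (logDer f s e) = locDer (∏ k, f k) e (logDer f s d) := by
  unfold logDer
  rw [map_sum, map_sum]
  refine Finset.sum_congr rfl fun k _ => ?_
  simp only [Derivation.leibniz, locDer_invFactor, locDer_algebraMap, hd, he, hde, smul_eq_mul,
    map_mul, map_zero, mul_zero]
  ring

/-- The action of `∂` on `R[1/(f₁⋯f_p)] · f₁^{s₁}⋯f_p^{s_p}`: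
`∂ (g · f^s) = (δ(g) + g ∑_k s_k δ(f_k) / f_k) · f^s`. -/
def twistedDer (d : Derivation ℂ R R) : Module.End ℂ (PowModule f) :=
  (locDer (∏ k, f k) d).toLinearMap + LinearMap.mulLeft ℂ (logDer f s d)

theorem twistedDer_apply (d : Derivation ℂ R R) (g : PowModule f) :
    twistedDer f s d g = locDer (∏ k, f k) d g + logDer f s d * g := rfl

/-- The natural action of the ring of differential operators on
`R[1/(f₁⋯f_p)] · f₁^{s₁}⋯f_p^{s_p}`. -/
def powAction (δ : Fin n → Derivation ℂ R R) (hδ : ∀ i j a, δ i (δ j a) = δ j (δ i a))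
    (hs : ∀ i k, δ i (s k) = 0) : DiffOp δ →ₐ[ℂ] Module.End ℂ (PowModule f) :=
  DiffOp.lift ((Algebra.lmul ℂ (PowModule f)).comp (IsScalarTower.toAlgHom ℂ R (PowModule f)))
    (fun i => twistedDer f s (δ i))
    (fun i a => by
      ext g
      simp only [Module.End.mul_apply, LinearMap.add_apply, AlgHom.comp_apply,
        IsScalarTower.coe_toAlgHom', Algebra.coe_lmul_eq_mul, LinearMap.mul_apply',
        twistedDer_apply, Derivation.leibniz, locDer_algebraMap, smul_eq_mul]
      ring)
    (fun i j => by
      ext g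
      simp only [Module.End.mul_apply, twistedDer_apply, map_add, Derivation.leibniz, smul_eq_mul]
      rw [locDer_comm _ (hδ i j), locDer_logDer f s (hδ i j) (hs i) (hs j)]
      ring)

/-- The annihilator of the symbol `f₁^{s₁}⋯f_p^{s_p}`, a left ideal. -/
def annPow (δ : Fin n → Derivation ℂ R R) (hδ : ∀ i j a, δ i (δ j a) = δ j (δ i a))
    (hs : ∀ i k, δ i (s k) = 0) : Ideal (DiffOp δ) where
  carrier := {P | powAction f s δ hδ hs P 1 = 0}
  add_mem' {P Q} hP hQ := by
    change powAction f s δ hδ hs (P + Q) 1 = 0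
    rw [map_add, LinearMap.add_apply, hP, hQ, add_zero]
  zero_mem' := by
    change powAction f s δ hδ hs 0 1 = 0
    rw [map_zero, LinearMap.zero_apply]
  smul_mem' Q P hP := by
    change powAction f s δ hδ hs (Q * P) 1 = 0
    rw [map_mul, Module.End.mul_apply, hP, map_zero]

end Operators

/-! ### The ring `𝒟_{ℂⁿ, x₀}[s₁, …, s_p]`, the annihilator and the operators `Ẽ`, `Ũ_{i,j}` -/

section Main

variable {n : ℕ}

/-- `∂/∂x_m` on `𝒪_{ℂⁿ, x₀}[s₁, …, s_p]`. -/
def polyPartial (p : ℕ) (x₀ : Fin n → ℂ) (m : Fin n) :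
    Derivation ℂ (MvPolynomial (Fin p) (Stalk x₀)) (MvPolynomial (Fin p) (Stalk x₀)) :=
  polyDer (partialDeriv x₀ m)

/-- The stalk `𝒟_{ℂⁿ, x₀}[s₁, …, s_p]` of the sheaf of differential operators with coefficients
in `𝒪_{ℂⁿ}[s₁, …, s_p]`. -/
abbrev DS (p : ℕ) (x₀ : Fin n → ℂ) : Type := DiffOp (polyPartial p x₀)

/-- The variable `s_k` as an operator. -/
def opS {p : ℕ} (x₀ : Fin n → ℂ) (k : Fin p) : DS p x₀ :=
  DiffOp.coeff _ (MvPolynomial.X k)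

/-- A linear form as an operator of order zero. -/
def opLin (p : ℕ) (x₀ : Fin n → ℂ) (φ : Module.Dual ℂ (Fin n → ℂ)) : DS p x₀ :=
  DiffOp.coeff _ (MvPolynomial.C (linGerm x₀ φ))

/-- The constant vector field `∑_m u_m ∂/∂x_m`. -/
def opField (p : ℕ) (x₀ : Fin n → ℂ) (u : Fin n → ℂ) : DS p x₀ :=
  ∑ m, u m • DiffOp.der _ m

/-- The Euler vector field `E = ∑_m x_m ∂/∂x_m`. -/
def opEuler (p : ℕ) (x₀ : Fin n → ℂ) : DS p x₀ :=
  ∑ m, opLin p x₀ (LinearMap.proj m) * DiffOp.der _ m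

/-- The left ideal `Ann(l₁^{s₁}⋯l_p^{s_p})` of `𝒟_{ℂⁿ, x₀}[s₁, …, s_p]`. -/
def Ann {p : ℕ} (l : Fin p → Module.Dual ℂ (Fin n → ℂ)) (x₀ : Fin n → ℂ) : Ideal (DS p x₀) :=
  annPow (fun k => MvPolynomial.C (linGerm x₀ (l k))) MvPolynomial.X (polyPartial p x₀)
    (fun _ _ a => polyDer_comm (dirDeriv_comm _ _) a) (fun _ k => polyDer_X _ k)

/-- The operator `Ẽ = E - s₁ - ⋯ - s_{n+1}`. -/
def opETilde (x₀ : Fin n → ℂ) : DS (n + 1) x₀ :=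
  opEuler (n + 1) x₀ - ∑ k, opS x₀ k

/-- The operator `Ũ_{i,j} = l_i l_j U_{i,j} - l_j s_i - U_{i,j}(l_j) l_i s_j`. -/
def opUTilde {l : Fin (n + 1) → Module.Dual ℂ (Fin n → ℂ)} (hl : Generic l) (x₀ : Fin n → ℂ)
    {i j : Fin (n + 1)} (hij : i ≠ j) : DS (n + 1) x₀ :=
  opLin _ x₀ (l i) * opLin _ x₀ (l j) * opField _ x₀ (constField hl hij)
    - opLin _ x₀ (l j) * opS x₀ i
    - l j (constField hl hij) • (opLin _ x₀ (l i) * opS x₀ j)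

end Main

end HyperplaneAnn

/-!
The annihilator of `l₀^{s₀}⋯lₙ^{sₙ}` is computed from the principal symbols of its elements,
for the filtration in which functions have order zero and both the `s_k` and the derivations have
order one.

Put `L = l₀` and `y_k = l_{k+1}` for `k < n`; the `y_k` are linear coordinates. Let `∂_k` be the
dual constant fields and `a_k = ∂_k(L)`, which is nonzero by genericity. Over the germs of functions,
the ring of operators is generated by `Ẽ`, by the `∂_k` and by `η_k = a_k⁻¹ (y_k ∂_k - s_{k+1})`
(`genOp`, `exists_mem_ordFiltration`): indeed `s_{k+1} = y_k ∂_k - a_k η_k` and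
`s₀ = ∑ a_k η_k - Ẽ`. In these terms `Ũ_{i+1,j+1} = a_i (y_j η_i - y_i η_j)` (`opUTilde_eq`).
The generators commute up to terms of lower order, so an operator of order `d` has a principal
symbol, a homogeneous polynomial of degree `d` in commuting variables (`exists_sub_quantize_mem`,
`quantize_mul_sub_mem`).

Applied to `l^s`, an operator yields a polynomial in `s` whose part of top degree is the value
of the principal symbol under the substitution `Ẽ ↦ 0`, `∂_k ↦ s_{k+1} / y_k + a_k s₀ / L`,
`η_k ↦ y_k s₀ / L` (`toPoly_quantize_sub_mem`). Hence the symbol of an operator annihilating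
`l^s` lies in the kernel of this substitution. With `T = s₀ / L` and with the images of
the `∂_k` as new variables, the kernel is seen to be generated by the symbol of `Ẽ` and by the
kernel of `η_k ↦ y_k T`, that is, by the equations of the Rees algebra of the ideal `(y_0, …, y_{n-1})`
(`mem_symbolIdeal_of_symbolHom_eq_zero`). For a weakly regular sequence these equations are
generated by the linear ones `y_j η_i - y_i η_j` (`mem_reesIdeal_of_eval_mem`), which are
symbols of the `Ũ`. An induction on the order then concludes (`le_of_symbols_mem_span`).

That the `y_k` are a weakly regular sequence of germs at every point follows from Hadamard's
lemma (`exists_analyticAt_sub_comp_eq_mul`, `mem_linIdeal_of_linGerm_mul_mem`), proved on power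
series: a germ vanishing on the zeros of `y_0, …, y_{k-1}` lies in the ideal generated by them.
-/


namespace HyperplaneAnn

/-! ### Division by a linear form in the ring of germs -/

section Division

variable {E : Type*} [NormedAddCommGroup E] [NormedSpace ℂ E]

/-- The difference of the values of a multilinear map at the diagonal points given by `w` and
`w - c • v` is `c` times a sum of values with one entry equal to `v`. -/
theorem multilinear_sub_diagonal {m : ℕ} (q : ContinuousMultilinearMap ℂ (fun _ : Fin m => E) ℂ)
    (w v : E) (c : ℂ) :
    (q fun _ => w) - (q fun _ => w - c • v) =
      c * ∑ j : Fin m, q fun i => if i < j then w else if i = j then v else w - c • v := by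
  classical
  set T : ℕ → ℂ := fun k => q fun i => if (i : ℕ) < k then w else w - c • v with hT
  have h1 : (q fun _ => w) = T m := by
    simp [hT]
  have h0 : (q fun _ => w - c • v) = T 0 := by
    simp [hT]
  rw [h1, h0, ← Finset.sum_range_sub, ← Fin.sum_univ_eq_sum_range (fun k => T (k + 1) - T k) m,
    Finset.mul_sum]
  refine Finset.sum_congr rfl fun j _ => ?_
  set μ : Fin m → E := fun i => if i < j then w else w - c • v with hμ
  have e1 : (fun i : Fin m => if (i : ℕ) < j + 1 then w else w - c • v) =
      Function.update μ j w := by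
    funext i
    rcases lt_trichotomy i j with h | h | h
    · rw [Function.update_of_ne h.ne, if_pos (by omega), hμ]
      simp [h]
    · subst h; simp
    · rw [Function.update_of_ne h.ne', if_neg (by omega), hμ]
      simp [h.le]
  have e2 : (fun i : Fin m => if (i : ℕ) < j then w else w - c • v) =
      Function.update μ j (w - c • v) := by
    funext i
    rcases lt_trichotomy i j with h | h | h
    · rw [Function.update_of_ne h.ne, hμ]; simp
    · subst h; simp
    · rw [Function.update_of_ne h.ne', hμ]; simp
  have e3 : (fun i : Fin m => if i < j then w else if i = j then v else w - c • v) =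
      Function.update μ j v := by
    funext i
    rcases lt_trichotomy i j with h | h | h
    · rw [Function.update_of_ne h.ne, hμ]; simp [h]
    · subst h; simp
    · rw [Function.update_of_ne h.ne', hμ]; simp [h.ne', h.le.not_gt]
  simp only [hT]
  rw [e1, e2, e3, ← q.map_update_sub, sub_sub_cancel, q.map_update_smul, smul_eq_mul]

/-- The power series of the quotient `(f - f ∘ π) / y`, where `π w = w - y w • v` and `p` is the
power series of `f`. -/
def divSeries (p : FormalMultilinearSeries ℂ E ℂ) (P : E →L[ℂ] E) (v : E) :
    FormalMultilinearSeries ℂ E ℂ := fun m =>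
  ∑ j : Fin (m + 1), ContinuousMultilinearMap.curryMid (Ei := fun _ => E) j
    ((p (m + 1)).compContinuousLinearMap
      (fun i => if i ≤ j then ContinuousLinearMap.id ℂ E else P)) v

theorem divSeries_apply (p : FormalMultilinearSeries ℂ E ℂ) (P : E →L[ℂ] E) (v w : E) (m : ℕ) :
    (divSeries p P v m fun _ => w) =
      ∑ j : Fin (m + 1), p (m + 1) fun i => if i < j then w else if i = j then v else P w := by
  unfold divSeries
  rw [sum_apply]
  refine Finset.sum_congr rfl fun j _ => ?_
  rw [ContinuousMultilinearMap.curryMid_apply,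
    ContinuousMultilinearMap.compContinuousLinearMap_apply]
  congr 1
  funext i
  rcases eq_or_ne i j with h | h
  · subst h; simp
  · obtain ⟨k, rfl⟩ := Fin.exists_succAbove_eq h
    rw [Fin.insertNth_apply_succAbove]
    by_cases h2 : j.succAbove k < j
    · simp [h2, h2.le]
    · have h3 : ¬ j.succAbove k ≤ j := fun h4 => h2 (lt_of_le_of_ne h4 h)
      simp [h2, h3, h]

theorem norm_divSeries_le (p : FormalMultilinearSeries ℂ E ℂ) (P : E →L[ℂ] E) (v : E) (m : ℕ) :
    ‖divSeries p P v m‖ ≤ (m + 1) * (‖p (m + 1)‖ * (1 + ‖P‖) ^ (m + 1) * ‖v‖) := by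
  unfold divSeries
  refine (norm_sum_le _ _).trans ?_
  have : ∀ j ∈ (Finset.univ : Finset (Fin (m + 1))),
      ‖ContinuousMultilinearMap.curryMid (Ei := fun _ => E) j
        ((p (m + 1)).compContinuousLinearMap
          (fun i => if i ≤ j then ContinuousLinearMap.id ℂ E else P)) v‖ ≤
        ‖p (m + 1)‖ * (1 + ‖P‖) ^ (m + 1) * ‖v‖ := by
    intro j _
    refine (ContinuousLinearMap.le_opNorm _ _).trans ?_
    rw [ContinuousMultilinearMap.norm_curryMid]
    refine mul_le_mul_of_nonneg_right ?_ (norm_nonneg _)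
    refine (ContinuousMultilinearMap.norm_compContinuousLinearMap_le _ _).trans ?_
    refine mul_le_mul_of_nonneg_left ?_ (norm_nonneg _)
    calc _ ≤ ∏ i : Fin (m + 1), (1 + ‖P‖) := by
          refine Finset.prod_le_prod (fun _ _ => norm_nonneg _) fun i _ => ?_
          split_ifs
          · exact ContinuousLinearMap.norm_id_le.trans (by linarith [norm_nonneg P])
          · linarith
      _ = _ := by simp
  refine (Finset.sum_le_sum this).trans ?_
  simp

theorem divSeries_radius_pos {p : FormalMultilinearSeries ℂ E ℂ} (hp : 0 < p.radius)
    (P : E →L[ℂ] E) (v : E) : 0 < (divSeries p P v).radius := by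
  obtain ⟨C, r, hC, hr, hb⟩ := p.le_mul_pow_of_radius_pos hp
  set B : ℝ := 1 + ‖P‖ with hB
  have hBpos : 0 < B := by have := norm_nonneg P; positivity
  set ρ : NNReal := ⟨1 / (2 * r * B), by positivity⟩ with hρ
  have hρpos : 0 < ρ := by
    rw [← NNReal.coe_pos, hρ]
    change 0 < 1 / (2 * r * B)
    positivity
  refine lt_of_lt_of_le (ENNReal.coe_pos.2 hρpos)
    (FormalMultilinearSeries.le_radius_of_bound _ (C * r * B * ‖v‖) fun m => ?_)
  -- the factor `2` in `ρ` absorbs the number `m + 1` of summands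
  have hm : ((m : ℝ) + 1) ≤ 2 ^ m := by
    exact_mod_cast Nat.succ_le_of_lt (Nat.lt_two_pow_self (n := m))
  have hρv : (ρ : ℝ) = 1 / (2 * r * B) := rfl
  calc ‖divSeries p P v m‖ * (ρ : ℝ) ^ m
      ≤ ((m + 1) * (‖p (m + 1)‖ * B ^ (m + 1) * ‖v‖)) * (ρ : ℝ) ^ m := by
        gcongr
        exact norm_divSeries_le p P v m
    _ ≤ (2 ^ m * (C * r ^ (m + 1) * B ^ (m + 1) * ‖v‖)) * (ρ : ℝ) ^ m := by
        gcongr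
        exact hb (m + 1)
    _ = C * r * B * ‖v‖ * (2 * r * B * (1 / (2 * r * B))) ^ m := by
        rw [hρv, mul_pow, mul_pow, mul_pow]; ring
    _ = C * r * B * ‖v‖ := by
        rw [mul_one_div_cancel (by positivity), one_pow, mul_one]

/-- Hadamard's lemma along the line `ℂ v`: if `y` vanishes at `x₀`, the difference of `f` and of
its pullback by `x ↦ x - y x • v` is analytically divisible by `y` near `x₀`. -/
theorem exists_analyticAt_sub_comp_eq_mul {f : E → ℂ} {x₀ : E} (hf : AnalyticAt ℂ f x₀)
    (y : E →L[ℂ] ℂ) (v : E) (hy : y x₀ = 0) :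
    ∃ g : E → ℂ, AnalyticAt ℂ g x₀ ∧ ∀ᶠ x in 𝓝 x₀, f x - f (x - y x • v) = y x * g x := by
  obtain ⟨p, hp⟩ := hf
  obtain ⟨r, hpr⟩ := hp
  set P : E →L[ℂ] E := ContinuousLinearMap.id ℂ E - y.smulRight v with hP
  have hPw : ∀ w, P w = w - y w • v := fun w => rfl
  have hq := divSeries_radius_pos hpr.radius_pos P v
  set q := divSeries p P v
  have hq2 := q.hasFPowerSeriesOnBall hq
  refine ⟨fun x => q.sum (x - x₀), ?_, ?_⟩
  · have := (hq2.comp_sub x₀).analyticAt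
    simpa using this
  have t1 : Filter.Tendsto (fun x => x - x₀) (𝓝 x₀) (𝓝 0) := by
    have : ContinuousAt (fun x => x - x₀) x₀ := by fun_prop
    simpa [ContinuousAt] using this
  have t2 : Filter.Tendsto (fun x => P (x - x₀)) (𝓝 x₀) (𝓝 0) := by
    have : ContinuousAt (fun x => P (x - x₀)) x₀ := by fun_prop
    simpa [ContinuousAt] using this
  have b1 := t1.eventually (Metric.eball_mem_nhds (0 : E) hpr.r_pos)
  have b2 := t2.eventually (Metric.eball_mem_nhds (0 : E) hpr.r_pos)
  have b3 := t1.eventually (Metric.eball_mem_nhds (0 : E) hq)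
  filter_upwards [b1, b2, b3] with x h1 h2 h3
  set w := x - x₀ with hw
  have s1 := hpr.hasSum h1
  have s2 := hpr.hasSum h2
  have s3 := hq2.hasSum h3
  have ex : x₀ + w = x := by rw [hw]; abel
  have eyw : y w = y x := by rw [hw, map_sub, hy, sub_zero]
  have ePx : x₀ + P w = x - y x • v := by rw [hPw, eyw, ← add_sub_assoc, ex]
  rw [ex] at s1
  rw [ePx] at s2
  rw [zero_add] at s3
  have s4 := (hasSum_nat_add_iff' 1).2 (s1.sub s2)
  simp only [Finset.range_one, Finset.sum_singleton] at s4
  have e0 : ((p 0) fun _ => w) - (p 0) (fun _ => P w) = 0 := by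
    rw [sub_eq_zero]; congr 1; funext i; exact i.elim0
  rw [e0, sub_zero] at s4
  have s5 := s3.mul_left (y x)
  have key : (fun m => ((p (m + 1)) fun _ => w) - (p (m + 1)) fun _ => P w) =
      fun m => y x * (q m) fun _ => w := by
    funext m
    rw [divSeries_apply, ← eyw]
    simp only [hPw]
    exact multilinear_sub_diagonal (p (m + 1)) w v (y w)
  rw [key] at s4
  exact s4.unique s5

end Division

/-! ### Linear forms as a regular sequence of germs -/

section Regular

variable {n : ℕ} {x₀ : Fin n → ℂ}

theorem germ_mul {f g : (Fin n → ℂ) → ℂ} (hf : AnalyticAt ℂ f x₀) (hg : AnalyticAt ℂ g x₀) :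
    germ f hf * germ g hg = germ (fun x => f x * g x) (hf.mul hg) := rfl

theorem germ_add {f g : (Fin n → ℂ) → ℂ} (hf : AnalyticAt ℂ f x₀) (hg : AnalyticAt ℂ g x₀) :
    germ f hf + germ g hg = germ (fun x => f x + g x) (hf.add hg) := rfl

theorem isUnit_linGerm {φ : Module.Dual ℂ (Fin n → ℂ)} (h : φ x₀ ≠ 0) :
    IsUnit (linGerm x₀ φ) := by
  have hφ := analyticAt_linearForm x₀ φ
  refine IsUnit.of_mul_eq_one (germ (fun x => (φ x)⁻¹) (hφ.inv h)) ?_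
  unfold linGerm
  rw [germ_mul]
  change _ = germ (fun _ => (1 : ℂ)) analyticAt_const
  rw [germ_eq_iff]
  filter_upwards [hφ.continuousAt.eventually_ne h] with x hx
  exact mul_inv_cancel₀ hx

/-- The ideal generated by the `y_i` with `i < k`. -/
def prefixIdeal {R : Type*} [CommRing R] {p : ℕ} (y : Fin p → R) (k : ℕ) : Ideal R :=
  Ideal.span {a | ∃ i : Fin p, (i : ℕ) < k ∧ a = y i}

/-- The ideal generated by the germs of the forms `y_i` with `i < k`. -/
abbrev linIdeal (x₀ : Fin n → ℂ) {p : ℕ} (y : Fin p → Module.Dual ℂ (Fin n → ℂ)) (k : ℕ) :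
    Ideal (Stalk x₀) :=
  prefixIdeal (fun i => linGerm x₀ (y i)) k

variable {p : ℕ} {y : Fin p → Module.Dual ℂ (Fin n → ℂ)}

theorem eventually_eq_zero_of_germ_mem_linIdeal {k : ℕ} {f : (Fin n → ℂ) → ℂ}
    (hf : AnalyticAt ℂ f x₀) (h : germ f hf ∈ linIdeal x₀ y k) :
    ∀ᶠ x in 𝓝 x₀, (∀ i : Fin p, (i : ℕ) < k → y i x = 0) → f x = 0 := by
  suffices H : ∀ a ∈ linIdeal x₀ y k, ∀ f hf, a = germ (x₀ := x₀) f hf →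
      ∀ᶠ x in 𝓝 x₀, (∀ i : Fin p, (i : ℕ) < k → y i x = 0) → f x = 0 from H _ h f hf rfl
  intro a ha
  induction ha using Submodule.span_induction with
  | mem a ha =>
    obtain ⟨i, hi, rfl⟩ := ha
    intro f hf e
    filter_upwards [germ_eq_iff.1 e] with x hx h0
    rw [← hx, h0 i hi]
  | zero =>
    intro f hf e
    have e' : germ (fun _ => (0 : ℂ)) analyticAt_const = germ f hf := e
    filter_upwards [germ_eq_iff.1 e'] with x hx _
    exact hx.symm
  | add a b _ _ iha ihb =>
    intro f hf e
    obtain ⟨g, hg, rfl⟩ := exists_germ a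
    obtain ⟨g', hg', rfl⟩ := exists_germ b
    rw [germ_add] at e
    filter_upwards [germ_eq_iff.1 e, iha g hg rfl, ihb g' hg' rfl] with x hx h1 h2 h0
    rw [← hx, h1 h0, h2 h0, add_zero]
  | smul c a _ iha =>
    intro f hf e
    obtain ⟨g, hg, rfl⟩ := exists_germ a
    obtain ⟨g', hg', rfl⟩ := exists_germ c
    rw [smul_eq_mul, germ_mul] at e
    filter_upwards [germ_eq_iff.1 e, iha g hg rfl] with x hx h1 h0
    rw [← hx, h1 h0, mul_zero]

variable {u : Fin p → Fin n → ℂ}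

/-- A germ vanishing on the common zeros of independent linear forms lies in the ideal which
they generate. The forms are treated one at a time, by Hadamard's lemma. -/
theorem germ_mem_linIdeal (hu : ∀ i j, y i (u j) = if i = j then 1 else 0) {k : ℕ} (hk : k ≤ p)
    {f : (Fin n → ℂ) → ℂ} (hf : AnalyticAt ℂ f x₀)
    (h : ∀ᶠ x in 𝓝 x₀, (∀ i : Fin p, (i : ℕ) < k → y i x = 0) → f x = 0) :
    germ f hf ∈ linIdeal x₀ y k := by
  induction k generalizing f with
  | zero =>
    have : germ f hf = 0 := by
      change _ = germ (fun _ => (0 : ℂ)) analyticAt_const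
      rw [germ_eq_iff]
      filter_upwards [h] with x hx
      exact hx fun i hi => absurd hi (Nat.not_lt_zero _)
    rw [this]
    exact zero_mem _
  | succ k ih =>
    set j : Fin p := ⟨k, hk⟩ with hj
    have hmem : linGerm x₀ (y j) ∈ linIdeal x₀ y (k + 1) :=
      Ideal.subset_span ⟨j, Nat.lt_succ_self k, rfl⟩
    by_cases hy : y j x₀ = 0
    swap
    · rw [Ideal.eq_top_of_isUnit_mem _ hmem (isUnit_linGerm hy)]
      trivial
    set Y : (Fin n → ℂ) →L[ℂ] ℂ := LinearMap.toContinuousLinearMap (y j) with hY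
    obtain ⟨g, hg, hfg⟩ := exists_analyticAt_sub_comp_eq_mul hf Y (u j) hy
    have hπ0 : x₀ - Y x₀ • u j = x₀ := by
      change x₀ - y j x₀ • u j = x₀
      rw [hy, zero_smul, sub_zero]
    have hπ : AnalyticAt ℂ (fun x => x - Y x • u j) x₀ :=
      (ContinuousLinearMap.id ℂ (Fin n → ℂ) - Y.smulRight (u j)).analyticAt x₀
    have hfπ : AnalyticAt ℂ (fun x => f (x - Y x • u j)) x₀ :=
      AnalyticAt.fun_comp (f := fun x => x - Y x • u j) (by rwa [hπ0]) hπ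
    have hI : germ _ hfπ ∈ linIdeal x₀ y k := by
      refine ih (Nat.le_of_succ_le hk) hfπ ?_
      have ht : Filter.Tendsto (fun x => x - Y x • u j) (𝓝 x₀) (𝓝 x₀) := by
        have := hπ.continuousAt.tendsto
        simp only [hπ0] at this
        exact this
      filter_upwards [ht.eventually h] with x hx h0
      refine hx fun i hi => ?_
      change y i (x - y j x • u j) = 0
      rw [map_sub, map_smul, hu, smul_eq_mul]
      rcases Nat.lt_succ_iff_lt_or_eq.1 hi with h1 | h1
      · rw [h0 i h1, if_neg (by rintro rfl; exact absurd h1 (lt_irrefl _))]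
        simp
      · have : i = j := Fin.ext h1
        subst this
        simp
    have e : germ f hf = germ _ hfπ + linGerm x₀ (y j) * germ g hg := by
      unfold linGerm
      rw [germ_mul, germ_add, germ_eq_iff]
      filter_upwards [hfg] with x hx
      change f x = f (x - Y x • u j) + Y x * g x
      rw [← hx]; ring
    rw [e]
    refine add_mem (Ideal.span_mono ?_ hI) (Ideal.mul_mem_right _ _ hmem)
    rintro a ⟨i, hi, rfl⟩
    exact ⟨i, hi.trans (Nat.lt_succ_self k), rfl⟩

/-- Independent linear forms are a weakly regular sequence in the ring of germs at any point. -/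
theorem mem_linIdeal_of_linGerm_mul_mem (hu : ∀ i j, y i (u j) = if i = j then 1 else 0)
    (k : Fin p) {a : Stalk x₀} (h : linGerm x₀ (y k) * a ∈ linIdeal x₀ y k) :
    a ∈ linIdeal x₀ y k := by
  obtain ⟨f, hf, rfl⟩ := exists_germ a
  refine germ_mem_linIdeal hu k.2.le hf ?_
  have h1 := eventually_eq_zero_of_germ_mem_linIdeal
    ((analyticAt_linearForm x₀ (y k)).mul hf) h
  filter_upwards [h1.eventually_nhds, hf.eventually_analyticAt] with x hx hfx h0
  -- the zeros of `y k` are limits of points where the other forms vanish and `y k` does not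
  have hc : ContinuousAt (fun t : ℂ => x + t • u k) 0 := by fun_prop
  have ht : Filter.Tendsto (fun t : ℂ => x + t • u k) (𝓝[≠] 0) (𝓝 x) := by
    have := hc.tendsto.mono_left (nhdsWithin_le_nhds (s := {0}ᶜ))
    simpa using this
  have hlim : Filter.Tendsto (fun t : ℂ => f (x + t • u k)) (𝓝[≠] 0) (𝓝 (f x)) :=
    hfx.continuousAt.tendsto.comp ht
  by_cases hy : y k x = 0
  swap
  · exact (mul_eq_zero.1 (hx.self_of_nhds h0)).resolve_left hy
  refine tendsto_nhds_unique (hlim.congr' ?_) tendsto_const_nhds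
  filter_upwards [ht.eventually hx, self_mem_nhdsWithin] with t htx ht0
  have h2 := htx fun i hi => by
    rw [map_add, map_smul, h0 i hi, hu, if_neg (by rintro rfl; exact absurd hi (lt_irrefl _))]
    simp
  change y k (x + t • u k) * f (x + t • u k) = 0 at h2
  rw [map_add, map_smul, hy, hu, if_pos rfl, smul_eq_mul, mul_one, zero_add] at h2
  exact (mul_eq_zero.1 h2).resolve_left ht0

theorem linGerm_mem_nonZeroDivisors {φ : Module.Dual ℂ (Fin n → ℂ)} (hφ : φ ≠ 0) :
    linGerm x₀ φ ∈ nonZeroDivisors (Stalk x₀) := by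
  obtain ⟨v, hv⟩ : ∃ v, φ v ≠ 0 := by
    by_contra! hc
    exact hφ (LinearMap.ext hc)
  rw [mem_nonZeroDivisors_iff_right]
  intro a ha
  have h := mem_linIdeal_of_linGerm_mul_mem (x₀ := x₀) (p := 1) (y := fun _ => φ)
    (u := fun _ => (φ v)⁻¹ • v) (fun i j => by
      rw [map_smul, smul_eq_mul, inv_mul_cancel₀ hv, if_pos (Subsingleton.elim _ _)]) 0 (a := a)
    (by rw [mul_comm, ha]; exact zero_mem _)
  have hbot : linIdeal x₀ (fun _ : Fin 1 => φ) ((0 : Fin 1) : ℕ) = ⊥ := by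
    unfold linIdeal prefixIdeal
    rw [Ideal.span_eq_bot]
    rintro a ⟨i, hi, -⟩
    exact absurd hi (Nat.not_lt_zero _)
  rw [hbot] at h
  exact h

end Regular

/-! ### The equations of the Rees algebra of a regular sequence -/

section Rees

open MvPolynomial

theorem homogeneousComponent_mul_of_isHomogeneous {σ R : Type*} [CommRing R] {d : ℕ}
    {g : MvPolynomial σ R} (hg : g.IsHomogeneous d) (q : MvPolynomial σ R) (m : ℕ) :
    homogeneousComponent (d + m) (g * q) = g * homogeneousComponent m q := by
  have hq := sum_homogeneousComponent q
  have h1 : ∀ i, homogeneousComponent (d + m) (g * homogeneousComponent i q) =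
      if m = i then g * homogeneousComponent i q else 0 := by
    intro i
    rw [homogeneousComponent_of_mem (hg.mul (homogeneousComponent_isHomogeneous i q))]
    simp
  conv_lhs => rw [← hq, Finset.mul_sum, map_sum]
  simp only [h1, Finset.sum_ite_eq, Finset.mem_range]
  split_ifs with h
  · rfl
  · rw [homogeneousComponent_eq_zero _ _ (by omega), mul_zero]

variable {R : Type*} [CommRing R] {p : ℕ}

/-- The ideal of `R[X]` generated by the `y_j X_i - y_i X_j`, by the `y_i` with `i < k` and by
the `X_i` with `i < k`. -/
def reesIdeal (y : Fin p → R) (k : ℕ) : Ideal (MvPolynomial (Fin p) R) :=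
  Ideal.span ({F | ∃ i j, F = C (y j) * X i - C (y i) * X j} ∪
    {F | ∃ i : Fin p, (i : ℕ) < k ∧ (F = C (y i) ∨ F = X i)})

theorem homogeneousComponent_mem_reesIdeal {y : Fin p → R} {k : ℕ} {F : MvPolynomial (Fin p) R}
    (hF : F ∈ reesIdeal y k) (m : ℕ) : homogeneousComponent m F ∈ reesIdeal y k := by
  let _ := gradedAlgebra (σ := Fin p) (R := R)
  refine homogeneousComponent_mem_of_mem (Ideal.homogeneous_span _ _ ?_) hF m
  rintro F (⟨i, j, rfl⟩ | ⟨i, -, rfl | rfl⟩)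
  · exact ⟨1, (isHomogeneous_C_mul_X _ _).sub (isHomogeneous_C_mul_X _ _)⟩
  · exact ⟨0, isHomogeneous_C _ _⟩
  · exact ⟨1, isHomogeneous_X _ _⟩

theorem eval_mem_of_mem_reesIdeal {y : Fin p → R} {k : ℕ} {F : MvPolynomial (Fin p) R}
    (hF : F ∈ reesIdeal y k) : eval y F ∈ prefixIdeal y k := by
  have : reesIdeal y k ≤
      (prefixIdeal y k).comap (eval y) := by
    refine Ideal.span_le.2 ?_
    rintro F (⟨i, j, rfl⟩ | ⟨i, hi, rfl | rfl⟩)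
    · simp [mul_comm]
    · rw [SetLike.mem_coe, Ideal.mem_comap, eval_C]
      exact Ideal.subset_span ⟨i, hi, rfl⟩
    · rw [SetLike.mem_coe, Ideal.mem_comap, eval_X]
      exact Ideal.subset_span ⟨i, hi, rfl⟩
  exact this hF

/-- Modulo the `y_j X_i - y_i X_j`, a factor `y_k` is traded for a factor `X_k`, up to the constant
term. -/
theorem exists_mul_X_sub_mem_reesIdeal (y : Fin p → R) (k : Fin p) (l : ℕ)
    (H : MvPolynomial (Fin p) R) :
    ∃ G, C (y k) * H - X k * G - C (y k * constantCoeff H) ∈ reesIdeal y l := by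
  induction H using MvPolynomial.induction_on with
  | C a => exact ⟨0, by simp⟩
  | add a b ha hb =>
    obtain ⟨A, hA⟩ := ha
    obtain ⟨B, hB⟩ := hb
    refine ⟨A + B, ?_⟩
    convert add_mem hA hB using 1
    simp only [map_add, mul_add]
    ring
  | mul_X q j _ =>
    refine ⟨C (y j) * q, ?_⟩
    have h : C (y k) * X j - C (y j) * X k ∈ reesIdeal y l :=
      Ideal.subset_span (Or.inl ⟨j, k, rfl⟩)
    convert Ideal.mul_mem_left _ q h using 1
    simp only [map_mul, constantCoeff_X, mul_zero, map_zero]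
    ring

theorem C_mem_reesIdeal {y : Fin p → R} {k : ℕ} {a : R}
    (ha : a ∈ prefixIdeal y k) : C a ∈ reesIdeal y k := by
  have : prefixIdeal y k ≤ (reesIdeal y k).comap C := by
    refine Ideal.span_le.2 ?_
    rintro a ⟨i, hi, rfl⟩
    exact Ideal.subset_span (Or.inr ⟨i, hi, Or.inl rfl⟩)
  exact this ha

/-- By descending induction on `k`: modulo `reesIdeal y k`, a homogeneous polynomial in
`reesIdeal y (k + 1)` is a multiple `X_k G`, and regularity of `y_k` allows to pass to `G`,
which has smaller degree. -/
theorem mem_reesIdeal_of_eval_mem {y : Fin p → R}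
    (hy : ∀ (k : Fin p) (a : R), y k * a ∈ prefixIdeal y k →
      a ∈ prefixIdeal y k)
    {k : ℕ} (hk : k ≤ p) (m : ℕ) {F : MvPolynomial (Fin p) R} (hF : F.IsHomogeneous m)
    (h : eval y F ∈ prefixIdeal y k) :
    F ∈ reesIdeal y k := by
  induction hk using Nat.decreasingInduction generalizing m F with
  | self =>
    -- here all the `X_i` belong to the ideal, so that only the constant term matters
    have key : F - C (constantCoeff F) ∈ reesIdeal y p := by
      clear hF h
      induction F using MvPolynomial.induction_on with
      | C a => simp
      | add a b ha hb =>
        convert add_mem ha hb using 1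
        simp only [map_add]; ring
      | mul_X q j _ =>
        simp only [map_mul, constantCoeff_X, mul_zero, map_zero, sub_zero]
        exact Ideal.mul_mem_left _ _ (Ideal.subset_span (Or.inr ⟨j, j.2, Or.inr rfl⟩))
    have h2 := eval_mem_of_mem_reesIdeal key
    rw [map_sub, eval_C] at h2
    have h3 := sub_mem h h2
    rw [sub_sub_cancel] at h3
    simpa using add_mem key (C_mem_reesIdeal h3)
  | of_succ k hkp ih =>
    set κ : Fin p := ⟨k, hkp⟩ with hκ
    induction m generalizing F with
    | zero =>
      obtain ⟨c, rfl⟩ : ∃ c, F = C c := by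
        have := homogeneousComponent_eq_self hF
        rw [homogeneousComponent_zero] at this
        exact ⟨_, this.symm⟩
      rw [eval_C] at h
      exact C_mem_reesIdeal h
    | succ m ihm =>
      have h1 : F ∈ reesIdeal y (k + 1) := by
        refine ih (m + 1) hF (Ideal.span_mono ?_ h)
        rintro a ⟨i, hi, rfl⟩
        exact ⟨i, hi.trans (Nat.lt_succ_self k), rfl⟩
      have h2 : reesIdeal y (k + 1) ≤
          reesIdeal y k ⊔ (Ideal.span {C (y κ)} ⊔ Ideal.span {X κ}) := by
        refine Ideal.span_le.2 ?_
        rintro F (⟨i, j, rfl⟩ | ⟨i, hi, hF⟩)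
        · exact Ideal.mem_sup_left (Ideal.subset_span (Or.inl ⟨i, j, rfl⟩))
        · rcases Nat.lt_succ_iff_lt_or_eq.1 hi with hi | hi
          · exact Ideal.mem_sup_left (Ideal.subset_span (Or.inr ⟨i, hi, hF⟩))
          · obtain rfl : i = κ := Fin.ext hi
            refine Ideal.mem_sup_right ?_
            rcases hF with rfl | rfl
            · exact Ideal.mem_sup_left (Ideal.mem_span_singleton_self _)
            · exact Ideal.mem_sup_right (Ideal.mem_span_singleton_self _)
      obtain ⟨a, ha, b, hb, hab⟩ := Submodule.mem_sup.1 (h2 h1)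
      obtain ⟨b', hb', b'', hb'', rfl⟩ := Submodule.mem_sup.1 hb
      obtain ⟨H, rfl⟩ := Ideal.mem_span_singleton'.1 hb'
      obtain ⟨G, rfl⟩ := Ideal.mem_span_singleton'.1 hb''
      obtain ⟨G', hG'⟩ := exists_mul_X_sub_mem_reesIdeal y κ k H
      have h3 : F - (X κ * (G + G') + C (y κ * constantCoeff H)) ∈ reesIdeal y k := by
        convert add_mem ha hG' using 1
        rw [← hab]; ring
      have h4 := homogeneousComponent_mem_reesIdeal h3 (1 + m)
      have h5 : homogeneousComponent (1 + m) (C (y κ * constantCoeff H) : MvPolynomial (Fin p) R)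
          = 0 := by
        rw [homogeneousComponent_of_mem (isHomogeneous_C _ _), if_neg (by omega)]
      rw [map_sub, map_add, homogeneousComponent_mul_of_isHomogeneous (isHomogeneous_X _ _), h5,
        add_zero, homogeneousComponent_eq_self (by rwa [add_comm])] at h4
      set G₀ := homogeneousComponent m (G + G')
      have h6 := eval_mem_of_mem_reesIdeal h4
      rw [map_sub, map_mul, eval_X] at h6
      have h8 := sub_mem h h6
      rw [sub_sub_cancel] at h8
      have h7 : G₀ ∈ reesIdeal y k :=
        ihm (homogeneousComponent_isHomogeneous _ _) (hy κ _ h8)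
      simpa using add_mem h4 (Ideal.mul_mem_left _ (X κ) h7)

/-- The kernel of `X_k ↦ y_k T` is generated by the `y_j X_i - y_i X_j` if the `y_k` form a
weakly regular sequence. -/
theorem mem_reesIdeal_of_eval₂_eq_zero {y : Fin p → R}
    (hy : ∀ (k : Fin p) (a : R), y k * a ∈ prefixIdeal y k →
      a ∈ prefixIdeal y k)
    {F : MvPolynomial (Fin p) R}
    (h : eval₂ Polynomial.C (fun k => Polynomial.C (y k) * Polynomial.X) F = 0) :
    F ∈ reesIdeal y 0 := by
  -- the substitution sends the component of degree `m` to a multiple of `T ^ m`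
  have hom : ∀ (m : ℕ) (G : MvPolynomial (Fin p) R), G.IsHomogeneous m →
      eval₂ Polynomial.C (fun k => Polynomial.C (y k) * Polynomial.X) G =
        Polynomial.C (eval y G) * Polynomial.X ^ m := by
    intro m G hG
    rw [eval₂_eq, eval_eq, map_sum, Finset.sum_mul]
    refine Finset.sum_congr rfl fun d hd => ?_
    have hdm : ∑ i ∈ d.support, d i = m := by
      by_contra hne
      exact (mem_support_iff.1 hd) (hG.coeff_eq_zero hne)
    simp only [mul_pow, Finset.prod_mul_distrib, Finset.prod_pow_eq_pow_sum, hdm, map_mul,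
      map_prod, map_pow, mul_assoc]
  rw [← sum_homogeneousComponent F]
  refine sum_mem fun m hm => ?_
  refine mem_reesIdeal_of_eval_mem hy (Nat.zero_le _) m (homogeneousComponent_isHomogeneous _ _) ?_
  have h1 : ∑ i ∈ Finset.range (F.totalDegree + 1),
      Polynomial.C (eval y (homogeneousComponent i F)) * Polynomial.X ^ i = 0 := by
    rw [← h]
    conv_rhs => rw [← sum_homogeneousComponent F, eval₂_sum]
    exact Finset.sum_congr rfl fun i _ => (hom i _ (homogeneousComponent_isHomogeneous _ _)).symm
  have h2 := congrArg (fun q => Polynomial.coeff q m) h1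
  simp only [Polynomial.finsetSum_coeff, Polynomial.coeff_C_mul_X_pow, Polynomial.coeff_zero,
    Finset.sum_ite_eq, hm, if_true] at h2
  rw [h2]
  exact zero_mem _

end Rees

/-! ### The ideal of principal symbols -/

section Symbols

open MvPolynomial

variable {R K : Type*} [CommRing R] [CommRing K] [Algebra R K] {n : ℕ}

/-- Index set of generators of the ring of operators over the coefficients: `none` stands for the
Euler operator, `some (inl k)` for a coordinate field and `some (inr k)` for the operator whose
symbol is `y_k s_0 / L`. -/
abbrev GenIdx (n : ℕ) : Type := Option (Fin n ⊕ Fin n)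

/-- The part linear in `s` of the action of the generators on `l^s`, where `l_0 = L` and
`l_{k+1} = y_k`, and where `a_k` is the derivative of `L` along the `k`-th coordinate field. -/
def genSymbol (y a : Fin n → R) (yinv : Fin n → K) (Linv : K) :
    GenIdx n → MvPolynomial (Fin (n + 1)) K
  | none => 0
  | some (Sum.inl k) => C (yinv k) * X k.succ + C (algebraMap R K (a k) * Linv) * X 0
  | some (Sum.inr k) => C (algebraMap R K (y k) * Linv) * X 0

/-- The ring homomorphism evaluating principal symbols on `l^s`. -/
def symbolHom (y a : Fin n → R) (yinv : Fin n → K) (Linv : K) :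
    MvPolynomial (GenIdx n) R →+* MvPolynomial (Fin (n + 1)) K :=
  eval₂Hom (C.comp (algebraMap R K)) (genSymbol y a yinv Linv)

/-- The ideal generated by the symbols of the Euler operator and of the operators `Ũ_{i,j}`. -/
def symbolIdeal (y : Fin n → R) : Ideal (MvPolynomial (GenIdx n) R) :=
  Ideal.span ({X none} ∪ {F | ∃ i j : Fin n,
    F = C (y j) * X (some (Sum.inr i)) - C (y i) * X (some (Sum.inr j))})

/-- In the coordinates `T = s_0 / L` and `ξ_k = s_{k+1} / y_k + a_k T` the evaluation of symbols
becomes, up to the variable of the Euler operator, the map `η_k ↦ y_k T` on coefficients of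
polynomials in `ξ`. -/
theorem mem_symbolIdeal_of_symbolHom_eq_zero {y a : Fin n → R} {yinv : Fin n → K} {L : R}
    {Linv : K} (hinj : Function.Injective (algebraMap R K))
    (hyinv : ∀ k, algebraMap R K (y k) * yinv k = 1) (hL : algebraMap R K L * Linv = 1)
    (hy : ∀ (k : Fin n) (b : R), y k * b ∈ prefixIdeal y k → b ∈ prefixIdeal y k)
    {F : MvPolynomial (GenIdx n) R} (hF : symbolHom y a yinv Linv F = 0) :
    F ∈ symbolIdeal y := by
  -- `β` is the change of coordinates, `γ` kills the Euler variable and makes the `ξ_k` the outer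
  -- variables, `ψ` is the substitution `η_k ↦ y_k T`, and `δ` is a section of `γ`
  let β : MvPolynomial (Fin (n + 1)) K →+* MvPolynomial (Fin n) (Polynomial K) :=
    eval₂Hom (C.comp Polynomial.C) (Fin.cons
      (C (Polynomial.C (algebraMap R K L) * Polynomial.X))
      (fun k => C (Polynomial.C (algebraMap R K (y k))) *
        (X k - C (Polynomial.C (algebraMap R K (a k)) * Polynomial.X))))
  let γ : MvPolynomial (GenIdx n) R →+* MvPolynomial (Fin n) (MvPolynomial (Fin n) R) :=
    eval₂Hom (C.comp C) (fun i => Option.elim i 0 (Sum.elim X fun k => C (X k)))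
  let ψ : MvPolynomial (Fin n) R →+* Polynomial K :=
    (Polynomial.mapRingHom (algebraMap R K)).comp
      (eval₂Hom Polynomial.C fun k => Polynomial.C (y k) * Polynomial.X)
  let δ : MvPolynomial (Fin n) (MvPolynomial (Fin n) R) →+* MvPolynomial (GenIdx n) R :=
    eval₂Hom (eval₂Hom C fun k => X (some (Sum.inr k))) fun k => X (some (Sum.inl k))
  have h1 : β.comp (symbolHom y a yinv Linv) = (map ψ).comp γ := by
    refine ringHom_ext (fun r => ?_) fun i => ?_
    · simp [β, γ, ψ, symbolHom]
    · rcases i with _ | k | k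
      · simp [β, γ, ψ, symbolHom, genSymbol]
      · have e1 : (C (Polynomial.C (algebraMap R K (y k))) : MvPolynomial (Fin n) (Polynomial K)) *
            C (Polynomial.C (yinv k)) = 1 := by
          rw [← C_mul, ← Polynomial.C_mul, hyinv, map_one, map_one]
        have e2 : (C (Polynomial.C (algebraMap R K L)) : MvPolynomial (Fin n) (Polynomial K)) *
            C (Polynomial.C Linv) = 1 := by
          rw [← C_mul, ← Polynomial.C_mul, hL, map_one, map_one]
        simp only [β, γ, ψ, symbolHom, genSymbol, RingHom.comp_apply, coe_eval₂Hom, eval₂_X,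
          eval₂_add, eval₂_mul, eval₂_C, Fin.cons_succ, Fin.cons_zero, map_mul, Option.elim,
          Sum.elim_inl, map_X]
        linear_combination (X k - C (Polynomial.C (algebraMap R K (a k))) * C Polynomial.X) * e1
          + C (Polynomial.C (algebraMap R K (a k))) * C Polynomial.X * e2
      · have e2 : (C (Polynomial.C (algebraMap R K L)) : MvPolynomial (Fin n) (Polynomial K)) *
            C (Polynomial.C Linv) = 1 := by
          rw [← C_mul, ← Polynomial.C_mul, hL, map_one, map_one]
        simp only [β, γ, ψ, symbolHom, genSymbol, RingHom.comp_apply, coe_eval₂Hom, eval₂_X,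
          eval₂_C, Fin.cons_zero, map_mul, Option.elim,
          Sum.elim_inr, map_C, Polynomial.coe_mapRingHom, Polynomial.map_C, Polynomial.map_X]
        linear_combination C (Polynomial.C (algebraMap R K (y k))) * C Polynomial.X * e2
  have h2 : γ F ∈ RingHom.ker (map ψ) := by
    rw [RingHom.mem_ker, ← RingHom.comp_apply, ← h1, RingHom.comp_apply, hF, map_zero]
  rw [MvPolynomial.ker_map] at h2
  have h3 : RingHom.ker ψ ≤ reesIdeal y 0 := by
    intro G hG
    refine mem_reesIdeal_of_eval₂_eq_zero hy ?_
    refine Polynomial.map_injective _ hinj ?_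
    rw [Polynomial.map_zero]
    exact hG
  have h4 : (Ideal.map C (RingHom.ker ψ)).map δ ≤ symbolIdeal y := by
    refine (Ideal.map_mono (Ideal.map_mono h3)).trans ?_
    rw [Ideal.map_map, Ideal.map_le_iff_le_comap]
    refine Ideal.span_le.2 ?_
    rintro G (⟨i, j, rfl⟩ | ⟨i, hi, -⟩)
    · rw [SetLike.mem_coe, Ideal.mem_comap]
      refine Ideal.subset_span (Or.inr ⟨i, j, ?_⟩)
      simp [δ]
    · exact absurd hi (Nat.not_lt_zero _)
  have h5 : δ (γ F) ∈ symbolIdeal y := h4 (Ideal.mem_map_of_mem δ h2)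
  have h6 : (Ideal.Quotient.mk (symbolIdeal y)).comp (δ.comp γ) =
      Ideal.Quotient.mk (symbolIdeal y) := by
    refine ringHom_ext (fun r => ?_) fun i => ?_
    · simp [δ, γ]
    · rcases i with _ | k | k
      · have : Ideal.Quotient.mk (symbolIdeal y) (X none) = 0 :=
          Ideal.Quotient.eq_zero_iff_mem.2 (Ideal.subset_span (Or.inl rfl))
        simp [δ, γ, this]
      · simp [δ, γ]
      · simp [δ, γ]
  rw [← Ideal.Quotient.eq_zero_iff_mem] at h5 ⊢
  rw [← h5]
  exact (RingHom.congr_fun h6 F).symm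

end Symbols

/-! ### Filtration by the order and principal symbols -/

section Filtration

open MvPolynomial

variable {R D ι : Type*} [CommRing R] [Ring D]

/-- The additive subgroup spanned over the coefficients by the words of length less than `d` in
the operators `e_i`; the elements of `ordFiltration c e (d + 1)` are the operators of order at most
`d`. -/
def ordFiltration (c : R →+* D) (e : ι → D) (d : ℕ) : AddSubgroup D :=
  AddSubgroup.closure {P | ∃ (r : R) (w : List ι), w.length < d ∧ P = c r * (w.map e).prod}

variable {c : R →+* D} {e : ι → D}

theorem word_mem_ordFiltration (r : R) {w : List ι} {d : ℕ} (h : w.length < d) :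
    c r * (w.map e).prod ∈ ordFiltration c e d :=
  AddSubgroup.subset_closure ⟨r, w, h, rfl⟩

theorem ordFiltration_mono {d d' : ℕ} (h : d ≤ d') : ordFiltration c e d ≤ ordFiltration c e d' :=
  AddSubgroup.closure_mono fun _ ⟨r, w, hw, hP⟩ => ⟨r, w, hw.trans_le h, hP⟩

theorem ordFiltration_zero : ordFiltration c e 0 = ⊥ := by
  unfold ordFiltration
  rw [AddSubgroup.closure_eq_bot_iff]
  rintro P ⟨r, w, hw, -⟩
  exact absurd hw (Nat.not_lt_zero _)

theorem map_mem_ordFiltration_of_words {d d' : ℕ} (f : D →+ D)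
    (h : ∀ (r : R) (w : List ι), w.length < d → f (c r * (w.map e).prod) ∈ ordFiltration c e d')
    {P : D} (hP : P ∈ ordFiltration c e d) : f P ∈ ordFiltration c e d' := by
  have : ordFiltration c e d ≤ (ordFiltration c e d').comap f := by
    refine (AddSubgroup.closure_le _).2 ?_
    rintro P ⟨r, w, hw, rfl⟩
    exact h r w hw
  exact this hP

theorem coeff_mul_mem_ordFiltration (r : R) {d : ℕ} {P : D} (hP : P ∈ ordFiltration c e d) :
    c r * P ∈ ordFiltration c e d :=
  map_mem_ordFiltration_of_words (AddMonoidHom.mulLeft (c r)) (fun r' w hw => by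
    rw [AddMonoidHom.coe_mulLeft, ← mul_assoc, ← map_mul]
    exact word_mem_ordFiltration _ hw) hP

theorem mul_word_mem_ordFiltration (w : List ι) {d : ℕ} {P : D} (hP : P ∈ ordFiltration c e d) :
    P * (w.map e).prod ∈ ordFiltration c e (d + w.length) :=
  map_mem_ordFiltration_of_words (AddMonoidHom.mulRight (w.map e).prod) (fun r w' hw => by
    rw [AddMonoidHom.mulRight_apply, mul_assoc, ← List.prod_append, ← List.map_append]
    exact word_mem_ordFiltration _ (by rw [List.length_append]; omega)) hP

theorem gen_mul_mem_ordFiltration (hc : ∀ i r, ∃ r', e i * c r = c r * e i + c r') (i : ι) {d : ℕ}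
    {P : D} (hP : P ∈ ordFiltration c e d) : e i * P ∈ ordFiltration c e (d + 1) :=
  map_mem_ordFiltration_of_words (AddMonoidHom.mulLeft (e i)) (fun r w hw => by
    obtain ⟨r', hr'⟩ := hc i r
    rw [AddMonoidHom.coe_mulLeft, ← mul_assoc, hr', add_mul, mul_assoc, ← List.prod_cons,
      ← List.map_cons]
    exact add_mem (word_mem_ordFiltration _ (by simpa using hw))
      (word_mem_ordFiltration _ (hw.trans (Nat.lt_succ_self _)))) hP

theorem word_mul_mem_ordFiltration (hc : ∀ i r, ∃ r', e i * c r = c r * e i + c r') (w : List ι)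
    {d : ℕ} {P : D} (hP : P ∈ ordFiltration c e d) :
    (w.map e).prod * P ∈ ordFiltration c e (d + w.length) := by
  induction w with
  | nil => simpa using hP
  | cons i w ih =>
    rw [List.map_cons, List.prod_cons, mul_assoc, List.length_cons, ← add_assoc]
    exact gen_mul_mem_ordFiltration hc i ih

theorem word_mul_coeff_sub_mem_ordFiltration (hc : ∀ i r, ∃ r', e i * c r = c r * e i + c r')
    (w : List ι) (r : R) :
    (w.map e).prod * c r - c r * (w.map e).prod ∈ ordFiltration c e w.length := by
  induction w with
  | nil => simp
  | cons i w ih =>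
    obtain ⟨r', hr'⟩ := hc i r
    have h1 := gen_mul_mem_ordFiltration hc i ih
    have h2 : c r' * (w.map e).prod ∈ ordFiltration c e (w.length + 1) :=
      word_mem_ordFiltration _ (Nat.lt_succ_self _)
    rw [List.map_cons, List.prod_cons, List.length_cons]
    convert add_mem h1 h2 using 1
    rw [mul_sub, ← mul_assoc (e i) (c r), hr']
    noncomm_ring

/-- Permuting the letters of a word changes the operator by one of smaller order. -/
theorem word_sub_word_mem_of_perm (hc : ∀ i r, ∃ r', e i * c r = c r * e i + c r')
    (he : ∀ i j, e i * e j - e j * e i ∈ ordFiltration c e 2) {w w' : List ι} (h : w.Perm w') :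
    (w.map e).prod - (w'.map e).prod ∈ ordFiltration c e w.length := by
  induction h with
  | nil => simp
  | cons i _ ih =>
    rw [List.map_cons, List.map_cons, List.prod_cons, List.prod_cons, ← mul_sub]
    exact gen_mul_mem_ordFiltration hc i ih
  | swap i j w =>
    have := mul_word_mem_ordFiltration w (he j i)
    rw [add_comm] at this
    convert this using 1
    · rfl
    rw [List.map_cons, List.map_cons, List.map_cons, List.map_cons, List.prod_cons,
      List.prod_cons, List.prod_cons, List.prod_cons]
    noncomm_ring
  | trans h1 _ ih1 ih2 =>
    rw [← h1.length_eq] at ih2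
    simpa using add_mem ih1 ih2

/-- The operator `∑ r_α e^α` attached to the polynomial `∑ r_α X^α`; the order of the factors in
`e^α` is chosen arbitrarily. -/
def quantize (c : R →+* D) (e : ι → D) : MvPolynomial ι R →+ D where
  toFun F := Finsupp.sum (AddMonoidAlgebra.coeff F) fun α r =>
    c r * (α.toMultiset.toList.map e).prod
  map_zero' := Finsupp.sum_zero_index
  map_add' F G := Finsupp.sum_add_index' (by simp) (by simp [add_mul])

theorem quantize_monomial (α : ι →₀ ℕ) (r : R) :
    quantize c e (monomial α r) = c r * (α.toMultiset.toList.map e).prod := by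
  change Finsupp.sum (Finsupp.single α r)
    (fun α r => c r * (α.toMultiset.toList.map e).prod) = _
  rw [Finsupp.sum_single_index (by simp)]

theorem quantize_C_mul_X (r : R) (i : ι) : quantize c e (C r * X i) = c r * e i := by
  rw [C_mul_X_eq_monomial, quantize_monomial, Finsupp.toMultiset_single]
  simp

theorem length_toList_toMultiset (α : ι →₀ ℕ) : α.toMultiset.toList.length = α.degree := by
  rw [Multiset.length_toList, Finsupp.card_toMultiset]
  rfl

theorem quantize_sum (F : MvPolynomial ι R) :
    quantize c e F = ∑ α ∈ F.support, quantize c e (monomial α (coeff α F)) := by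
  conv_lhs => rw [F.as_sum, map_sum]

/-- Every operator of order at most `d` has a principal symbol of degree `d`. -/
theorem exists_sub_quantize_mem (hc : ∀ i r, ∃ r', e i * c r = c r * e i + c r')
    (he : ∀ i j, e i * e j - e j * e i ∈ ordFiltration c e 2) {d : ℕ} {P : D}
    (hP : P ∈ ordFiltration c e (d + 1)) :
    ∃ F : MvPolynomial ι R, F.IsHomogeneous d ∧ P - quantize c e F ∈ ordFiltration c e d := by
  classical
  unfold ordFiltration at hP
  induction hP using AddSubgroup.closure_induction with
  | mem P hP =>
    obtain ⟨r, w, hw, rfl⟩ := hP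
    rcases Nat.lt_succ_iff_lt_or_eq.1 hw with h | h
    · exact ⟨0, isHomogeneous_zero _ _ _, by
        rw [map_zero, sub_zero]; exact word_mem_ordFiltration r h⟩
    · refine ⟨monomial (Multiset.toFinsupp (w : Multiset ι)) r, isHomogeneous_monomial _ ?_, ?_⟩
      · rw [← length_toList_toMultiset, Multiset.toFinsupp_toMultiset, Multiset.length_toList,
          Multiset.coe_card, h]
      · rw [quantize_monomial, Multiset.toFinsupp_toMultiset, ← mul_sub, ← h]
        refine coeff_mul_mem_ordFiltration r (word_sub_word_mem_of_perm hc he ?_)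
        rw [← Multiset.coe_eq_coe, Multiset.coe_toList]
  | zero => exact ⟨0, isHomogeneous_zero _ _ _, by simp⟩
  | add P P' _ _ h h' =>
    obtain ⟨F, hF, h⟩ := h
    obtain ⟨F', hF', h'⟩ := h'
    refine ⟨F + F', hF.add hF', ?_⟩
    rw [map_add, add_sub_add_comm]
    exact add_mem h h'
  | neg P _ h =>
    obtain ⟨F, hF, h⟩ := h
    refine ⟨-F, hF.neg, ?_⟩
    rw [map_neg, ← neg_sub']
    exact neg_mem h

/-- Products of operators correspond to products of symbols, up to terms of smaller order. -/
theorem quantize_mul_sub_mem (hc : ∀ i r, ∃ r', e i * c r = c r * e i + c r')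
    (he : ∀ i j, e i * e j - e j * e i ∈ ordFiltration c e 2) {d d' : ℕ} {F G : MvPolynomial ι R}
    (hF : F.IsHomogeneous d) (hG : G.IsHomogeneous d') :
    quantize c e (F * G) - quantize c e F * quantize c e G ∈ ordFiltration c e (d + d') := by
  have h1 : quantize c e (F * G) = ∑ α ∈ F.support, ∑ β ∈ G.support,
      quantize c e (monomial α (coeff α F) * monomial β (coeff β G)) := by
    conv_lhs => rw [F.as_sum, G.as_sum, Finset.sum_mul_sum]
    simp only [map_sum]
  rw [h1, quantize_sum F, quantize_sum G, Finset.sum_mul_sum, ← Finset.sum_sub_distrib]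
  refine sum_mem fun α hα => ?_
  rw [← Finset.sum_sub_distrib]
  refine sum_mem fun β hβ => ?_
  have hα' : α.degree = d := by
    by_contra h; exact (mem_support_iff.1 hα) (hF.coeff_eq_zero h)
  have hβ' : β.degree = d' := by
    by_contra h; exact (mem_support_iff.1 hβ) (hG.coeff_eq_zero h)
  rw [monomial_mul, quantize_monomial, quantize_monomial, quantize_monomial]
  set r := coeff α F
  set r' := coeff β G
  set u := α.toMultiset.toList with hu
  set w := β.toMultiset.toList with hw
  have hlu : u.length = d := by rw [hu, length_toList_toMultiset, hα']
  have hlw : w.length = d' := by rw [hw, length_toList_toMultiset, hβ']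
  have hperm : ((α + β).toMultiset.toList).Perm (u ++ w) := by
    rw [← Multiset.coe_eq_coe, Multiset.coe_toList, ← Multiset.coe_add, hu, hw,
      Multiset.coe_toList, Multiset.coe_toList, map_add]
  have h2 := coeff_mul_mem_ordFiltration (r * r') (word_sub_word_mem_of_perm hc he hperm)
  have h3 := coeff_mul_mem_ordFiltration r
    (mul_word_mem_ordFiltration w (word_mul_coeff_sub_mem_ordFiltration hc u r'))
  rw [hperm.length_eq, List.length_append, hlu, hlw] at h2
  rw [hlu, hlw] at h3
  convert sub_mem h2 h3 using 1
  rw [List.map_append, List.prod_append, map_mul]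
  noncomm_ring

/-- The homogeneous components of an element of an ideal generated by linear symbols of elements
of a left ideal `I` are symbols of elements of `I`. -/
theorem exists_mem_sub_quantize_mem (hc : ∀ i r, ∃ r', e i * c r = c r * e i + c r')
    (he : ∀ i j, e i * e j - e j * e i ∈ ordFiltration c e 2) {S : Set (MvPolynomial ι R)}
    (hS : ∀ g ∈ S, g.IsHomogeneous 1) {I : Ideal D} (hI : ∀ g ∈ S, quantize c e g ∈ I)
    {F : MvPolynomial ι R} (hF : F ∈ Ideal.span S) (m : ℕ) :
    ∃ P ∈ I, P - quantize c e (homogeneousComponent m F) ∈ ordFiltration c e m := by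
  suffices H : ∀ q m, ∃ P ∈ I,
      P - quantize c e (homogeneousComponent m (q * F)) ∈ ordFiltration c e m by
    simpa using H 1 m
  clear m
  induction hF using Submodule.span_induction with
  | mem g hg =>
    intro q m
    rcases m with _ | m
    · refine ⟨0, zero_mem _, ?_⟩
      have h0 : coeff 0 g = 0 := (hS g hg).coeff_eq_zero (by simp)
      have h1 : coeff 0 (q * g) = 0 := by
        rw [← constantCoeff_eq, map_mul, constantCoeff_eq, h0, mul_zero]
      rw [homogeneousComponent_zero, h1]
      simp
    · refine ⟨quantize c e (homogeneousComponent m q) * quantize c e g,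
        I.mul_mem_left _ (hI g hg), ?_⟩
      rw [mul_comm q, add_comm m, homogeneousComponent_mul_of_isHomogeneous (hS g hg),
        mul_comm g, ← neg_sub, add_comm 1]
      exact neg_mem (quantize_mul_sub_mem hc he (homogeneousComponent_isHomogeneous _ _)
        (hS g hg))
  | zero => exact fun q m => ⟨0, zero_mem _, by simp⟩
  | add F G _ _ ihF ihG =>
    intro q m
    obtain ⟨P, hP, hP'⟩ := ihF q m
    obtain ⟨Q, hQ, hQ'⟩ := ihG q m
    refine ⟨P + Q, add_mem hP hQ, ?_⟩
    rw [mul_add, map_add, map_add, add_sub_add_comm]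
    exact add_mem hP' hQ'
  | smul a F _ ih =>
    intro q m
    rw [smul_eq_mul, ← mul_assoc]
    exact ih (q * a) m

/-- A left ideal `J` is contained in the left ideal `I` if all principal symbols of elements
of `J` lie in an ideal generated by linear symbols of elements of `I`. -/
theorem le_of_symbols_mem_span (hc : ∀ i r, ∃ r', e i * c r = c r * e i + c r')
    (he : ∀ i j, e i * e j - e j * e i ∈ ordFiltration c e 2)
    (hD : ∀ P, ∃ d, P ∈ ordFiltration c e d) {S : Set (MvPolynomial ι R)}
    (hS : ∀ g ∈ S, g.IsHomogeneous 1) {I J : Ideal D} (hI : ∀ g ∈ S, quantize c e g ∈ I)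
    (hIJ : I ≤ J)
    (hJ : ∀ P ∈ J, ∀ (d : ℕ) (F : MvPolynomial ι R), F.IsHomogeneous d →
      P - quantize c e F ∈ ordFiltration c e d → F ∈ Ideal.span S) : J ≤ I := by
  have H : ∀ d, ∀ P ∈ ordFiltration c e d, P ∈ J → P ∈ I := by
    intro d
    induction d with
    | zero =>
      intro P hP _
      rw [ordFiltration_zero, AddSubgroup.mem_bot] at hP
      rw [hP]
      exact zero_mem _
    | succ d ih =>
      intro P hP hPJ
      obtain ⟨F, hF, hPF⟩ := exists_sub_quantize_mem hc he hP
      obtain ⟨Q, hQ, hQF⟩ := exists_mem_sub_quantize_mem hc he hS hI (hJ P hPJ d F hF hPF) d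
      rw [homogeneousComponent_eq_self hF] at hQF
      have h1 := sub_mem hPF hQF
      rw [sub_sub_sub_cancel_right] at h1
      have h2 := ih _ h1 (sub_mem hPJ (hIJ hQ))
      simpa using add_mem h2 hQ
  intro P hP
  obtain ⟨d, hd⟩ := hD P
  exact H d P hd hP

end Filtration

/-! ### The action of operators on top-degree parts in `s` -/

section TopDegree

open MvPolynomial

/-- Polynomials of total degree less than `d`. -/
def degreeLT {σ K : Type*} [CommRing K] (d : ℕ) : AddSubgroup (MvPolynomial σ K) where
  carrier := {b | ∀ α : σ →₀ ℕ, d ≤ α.degree → coeff α b = 0}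
  add_mem' ha hb α hα := by rw [coeff_add, ha α hα, hb α hα, add_zero]
  zero_mem' α _ := coeff_zero α
  neg_mem' ha α hα := by rw [coeff_neg, ha α hα, neg_zero]

section

variable {σ K : Type*} [CommRing K]

theorem degreeLT_mono {d d' : ℕ} (h : d ≤ d') :
    degreeLT (σ := σ) (K := K) d ≤ degreeLT d' := fun _ hb α hα => hb α (h.trans hα)

theorem isHomogeneous_mem_degreeLT {d d' : ℕ} (h : d < d') {b : MvPolynomial σ K}
    (hb : b.IsHomogeneous d) : b ∈ degreeLT d' :=
  fun _ hα => hb.coeff_eq_zero (by omega)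

theorem eq_zero_of_isHomogeneous_of_mem_degreeLT {d : ℕ} {b : MvPolynomial σ K}
    (hb : b.IsHomogeneous d) (h : b ∈ degreeLT d) : b = 0 := by
  ext α
  by_cases hα : α.degree = d
  · exact h α hα.ge
  · exact hb.coeff_eq_zero hα

theorem mul_mem_degreeLT {d e : ℕ} {φ b : MvPolynomial σ K} (hφ : φ.IsHomogeneous e)
    (hb : b ∈ degreeLT d) : φ * b ∈ degreeLT (d + e) := by
  classical
  intro α hα
  rw [coeff_mul]
  refine Finset.sum_eq_zero fun x hx => ?_
  rw [Finset.HasAntidiagonal.mem_antidiagonal] at hx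
  by_cases h : x.1.degree = e
  · rw [hb x.2, mul_zero]
    rw [← hx, map_add, h] at hα
    omega
  · rw [hφ.coeff_eq_zero h, zero_mul]

end

theorem coeff_polyDer {σ K : Type} [CommRing K] [Algebra ℂ K] (d : Derivation ℂ K K)
    (b : MvPolynomial σ K) (α : σ →₀ ℕ) : coeff α (polyDer d b) = d (coeff α b) := by
  classical
  induction b using MvPolynomial.induction_on generalizing α with
  | C a =>
    rw [polyDer_C, coeff_C, coeff_C]
    split_ifs <;> simp
  | add p q hp hq => rw [map_add, coeff_add, coeff_add, hp, hq, map_add]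
  | mul_X p k hp =>
    rw [Derivation.leibniz, polyDer_X, smul_zero, zero_add, smul_eq_mul, mul_comm (X k),
      coeff_mul_X', coeff_mul_X', hp]
    split_ifs <;> simp

theorem polyDer_mem_degreeLT {σ K : Type} [CommRing K] [Algebra ℂ K] (δ : Derivation ℂ K K) {d : ℕ}
    {b : MvPolynomial σ K} (hb : b ∈ degreeLT d) : polyDer δ b ∈ degreeLT d := fun α hα => by
  rw [coeff_polyDer, hb α hα, map_zero]

variable {R : Type} [CommRing R] [Algebra ℂ R] {p : ℕ} (g : Fin p → R)

/-- The module of elements `h · g₁^{s₁}⋯g_p^{s_p}` with `h ∈ R[s, 1/(g₁⋯g_p)]`. -/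
abbrev SymbolModule : Type := PowModule (fun k => (C (g k) : MvPolynomial (Fin p) R))

omit [Algebra ℂ R] in
theorem isUnit_map_prod :
    IsUnit (MvPolynomial.map (σ := Fin p) (algebraMap R (PowModule g)) (∏ k, C (g k))) := by
  rw [← map_prod, map_C]
  exact (IsLocalization.Away.algebraMap_isUnit (∏ k, g k)).map C

/-- The canonical map `R[s][1/(g₁⋯g_p)] → R[1/(g₁⋯g_p)][s]`, by which degrees in `s` are
measured. -/
def toPoly : SymbolModule g →+* MvPolynomial (Fin p) (PowModule g) :=
  IsLocalization.Away.lift (∏ k, C (g k)) (isUnit_map_prod g)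

omit [Algebra ℂ R] in
theorem toPoly_algebraMap (a : MvPolynomial (Fin p) R) :
    toPoly g (algebraMap _ _ a) = MvPolynomial.map (algebraMap R (PowModule g)) a :=
  IsLocalization.Away.lift_eq _ _ _

theorem toPoly_invFactor (k : Fin p) :
    toPoly g (invFactor (fun k => (C (g k) : MvPolynomial (Fin p) R)) k) = C (invFactor g k) := by
  have h1 := congrArg (toPoly g) (mul_invFactor (fun k => (C (g k) : MvPolynomial (Fin p) R)) k)
  rw [map_mul, toPoly_algebraMap, map_C, map_one] at h1
  have h2 : (C (algebraMap R (PowModule g) (g k)) : MvPolynomial (Fin p) (PowModule g)) *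
      C (invFactor g k) = 1 := by
    rw [← C_mul, mul_invFactor, C_1]
  calc _ = (C (algebraMap R (PowModule g) (g k)) * C (invFactor g k)) * toPoly g _ := by
        rw [h2, one_mul]
    _ = C (invFactor g k) * (C (algebraMap R (PowModule g) (g k)) * toPoly g _) := by ring
    _ = _ := by rw [h1, mul_one]

theorem polyDer_locDer_map (d : Derivation ℂ R R) (a : MvPolynomial (Fin p) R) :
    polyDer (locDer (∏ k, g k) d) (MvPolynomial.map (algebraMap R (PowModule g)) a) =
      MvPolynomial.map (algebraMap R (PowModule g)) (polyDer d a) := by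
  ext α
  rw [coeff_polyDer, coeff_map, coeff_map, coeff_polyDer, locDer_algebraMap]

theorem toPoly_locDer (d : Derivation ℂ R R) (x : SymbolModule g) :
    toPoly g (locDer (∏ k, C (g k)) (polyDer d) x) =
      polyDer (locDer (∏ k, g k) d) (toPoly g x) := by
  obtain ⟨k, a, hka⟩ := IsLocalization.Away.surj (S := SymbolModule g)
    (∏ k, C (g k) : MvPolynomial (Fin p) R) x
  have hu := (isUnit_map_prod g).pow k
  have h1 := congrArg (fun z => toPoly g (locDer (∏ k, C (g k)) (polyDer d) z)) hka
  have h2 := congrArg (fun z => polyDer (locDer (∏ k, g k) d) (toPoly g z)) hka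
  rw [← map_pow] at hu h1 h2
  simp only [map_mul, Derivation.leibniz, locDer_algebraMap, smul_eq_mul, map_add,
    toPoly_algebraMap, polyDer_locDer_map] at h1 h2
  rw [← h2] at h1
  exact hu.mul_left_cancel (add_left_cancel h1)

theorem toPoly_logDer (d : Derivation ℂ R R) :
    toPoly g (logDer (fun k => C (g k)) X (polyDer d)) =
      ∑ k, C (algebraMap R (PowModule g) (d (g k)) * invFactor g k) * X k := by
  unfold logDer
  rw [map_sum]
  refine Finset.sum_congr rfl fun k _ => ?_
  rw [map_mul, toPoly_algebraMap, toPoly_invFactor, polyDer_C, map_mul, map_X, map_C, C_mul]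
  ring

variable {g}

/-- `T` maps `1` to `φ`, and multiplies the part of top degree in `s` by `φ`. -/
def HasSymbol (T : Module.End ℂ (SymbolModule g)) (φ : MvPolynomial (Fin p) (PowModule g)) :
    Prop :=
  toPoly g (T 1) = φ ∧ ∀ (d : ℕ) (x : SymbolModule g), toPoly g x ∈ degreeLT d →
    toPoly g (T x) - φ * toPoly g x ∈ degreeLT d

theorem HasSymbol.add {T U : Module.End ℂ (SymbolModule g)}
    {φ ψ : MvPolynomial (Fin p) (PowModule g)} (hT : HasSymbol T φ) (hU : HasSymbol U ψ) :
    HasSymbol (T + U) (φ + ψ) := by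
  refine ⟨by rw [LinearMap.add_apply, map_add, hT.1, hU.1], fun d x hx => ?_⟩
  rw [LinearMap.add_apply, map_add, add_mul, add_sub_add_comm]
  exact add_mem (hT.2 d x hx) (hU.2 d x hx)

theorem HasSymbol.neg {T : Module.End ℂ (SymbolModule g)}
    {φ : MvPolynomial (Fin p) (PowModule g)} (hT : HasSymbol T φ) : HasSymbol (-T) (-φ) := by
  refine ⟨by rw [LinearMap.neg_apply, map_neg, hT.1], fun d x hx => ?_⟩
  convert neg_mem (hT.2 d x hx) using 1
  rw [LinearMap.neg_apply, map_neg]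
  ring

theorem HasSymbol.sub {T U : Module.End ℂ (SymbolModule g)}
    {φ ψ : MvPolynomial (Fin p) (PowModule g)} (hT : HasSymbol T φ) (hU : HasSymbol U ψ) :
    HasSymbol (T - U) (φ - ψ) := by
  rw [sub_eq_add_neg, sub_eq_add_neg]
  exact hT.add hU.neg

theorem hasSymbol_zero : HasSymbol (0 : Module.End ℂ (SymbolModule g)) 0 :=
  ⟨by simp, fun d x _ => by simp⟩

theorem HasSymbol.sum {κ : Type*} (s : Finset κ) {T : κ → Module.End ℂ (SymbolModule g)}
    {φ : κ → MvPolynomial (Fin p) (PowModule g)} (h : ∀ i ∈ s, HasSymbol (T i) (φ i)) :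
    HasSymbol (∑ i ∈ s, T i) (∑ i ∈ s, φ i) := by
  classical
  induction s using Finset.induction_on with
  | empty => simpa using hasSymbol_zero
  | insert a s ha ih =>
    rw [Finset.sum_insert ha, Finset.sum_insert ha]
    exact (h a (Finset.mem_insert_self _ _)).add
      (ih fun i hi => h i (Finset.mem_insert_of_mem hi))

theorem HasSymbol.lmul_C {T : Module.End ℂ (SymbolModule g)}
    {φ : MvPolynomial (Fin p) (PowModule g)} (hT : HasSymbol T φ) (a : R) :
    HasSymbol (Algebra.lmul ℂ (SymbolModule g) (algebraMap (MvPolynomial (Fin p) R) _ (C a)) * T)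
      (C (algebraMap R _ a) * φ) := by
  have h : ∀ x, toPoly g ((Algebra.lmul ℂ (SymbolModule g)
      (algebraMap (MvPolynomial (Fin p) R) _ (C a)) * T) x) =
      C (algebraMap R _ a) * toPoly g (T x) := fun x => by
    rw [Module.End.mul_apply, Algebra.coe_lmul_eq_mul, LinearMap.mul_apply', map_mul,
      toPoly_algebraMap, map_C]
  refine ⟨by rw [h, hT.1], fun d x hx => ?_⟩
  rw [h, mul_assoc, ← mul_sub]
  exact mul_mem_degreeLT (isHomogeneous_C _ _) (hT.2 d x hx)

theorem hasSymbol_lmul_X (k : Fin p) :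
    HasSymbol (Algebra.lmul ℂ (SymbolModule g) (algebraMap (MvPolynomial (Fin p) R) _ (X k)))
      (X k) := by
  have h : ∀ x, toPoly g (Algebra.lmul ℂ (SymbolModule g)
      (algebraMap (MvPolynomial (Fin p) R) _ (X k)) x) = X k * toPoly g x := fun x => by
    rw [Algebra.coe_lmul_eq_mul, LinearMap.mul_apply', map_mul, toPoly_algebraMap, map_X]
  refine ⟨by rw [h, map_one, mul_one], fun d x _ => ?_⟩
  rw [h, sub_self]
  exact zero_mem _

theorem hasSymbol_twistedDer (d : Derivation ℂ R R) :
    HasSymbol (twistedDer (fun k => C (g k)) X (polyDer d) : Module.End ℂ (SymbolModule g))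
      (∑ k, C (algebraMap R (PowModule g) (d (g k)) * invFactor g k) * X k) := by
  refine ⟨?_, fun e x hx => ?_⟩
  · rw [twistedDer_apply, Derivation.map_one_eq_zero, zero_add, mul_one, toPoly_logDer]
  · rw [twistedDer_apply, map_add, map_mul, toPoly_logDer, add_sub_cancel_right, toPoly_locDer]
    exact polyDer_mem_degreeLT _ hx

omit [Algebra ℂ R] in
theorem toPoly_injective (h : Function.Injective (algebraMap R (PowModule g))) :
    Function.Injective (toPoly g) := by
  refine (IsLocalization.lift_injective_iff _).2 fun a b => ⟨fun hab => ?_, fun hab => ?_⟩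
  · have := congrArg (toPoly g) hab
    rwa [toPoly_algebraMap, toPoly_algebraMap] at this
  · rw [map_injective _ h hab]

variable {D ι : Type*} [Ring D] {c : R →+* D} {e : ι → D}
  {ρ : D →+* Module.End ℂ (SymbolModule g)} {φ : ι → MvPolynomial (Fin p) (PowModule g)}

omit [Algebra ℂ R] in
theorem isHomogeneous_word (hφ : ∀ i, (φ i).IsHomogeneous 1) (w : List ι) :
    (w.map φ).prod.IsHomogeneous w.length := by
  induction w with
  | nil => exact isHomogeneous_one _ _
  | cons i w ih =>
    rw [List.map_cons, List.prod_cons, List.length_cons, add_comm]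
    exact (hφ i).mul ih

theorem toPoly_word_sub_mem (hφ : ∀ i, (φ i).IsHomogeneous 1)
    (he : ∀ i, HasSymbol (ρ (e i)) (φ i)) (w : List ι) :
    toPoly g (ρ (w.map e).prod 1) - (w.map φ).prod ∈ degreeLT w.length := by
  induction w with
  | nil => simp [zero_mem]
  | cons i w ih =>
    have h1 : toPoly g (ρ (w.map e).prod 1) ∈ degreeLT (w.length + 1) := by
      have := add_mem (degreeLT_mono (Nat.le_succ _) ih)
        (isHomogeneous_mem_degreeLT (Nat.lt_succ_self _) (isHomogeneous_word hφ w))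
      simpa using this
    have h2 := (he i).2 _ _ h1
    have h3 := mul_mem_degreeLT (hφ i) ih
    rw [List.map_cons, List.map_cons, List.prod_cons, List.prod_cons, map_mul,
      Module.End.mul_apply, List.length_cons]
    convert add_mem h2 h3 using 1
    ring

theorem toPoly_coeff_mul (hc : ∀ r, ρ (c r) =
      Algebra.lmul ℂ (SymbolModule g) (algebraMap (MvPolynomial (Fin p) R) _ (C r))) (r : R)
    (P : D) : toPoly g (ρ (c r * P) 1) = C (algebraMap R _ r) * toPoly g (ρ P 1) := by
  rw [map_mul, Module.End.mul_apply, hc, Algebra.coe_lmul_eq_mul, LinearMap.mul_apply', map_mul,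
    toPoly_algebraMap, map_C]

theorem toPoly_mem_degreeLT (hc : ∀ r, ρ (c r) =
      Algebra.lmul ℂ (SymbolModule g) (algebraMap (MvPolynomial (Fin p) R) _ (C r)))
    (hφ : ∀ i, (φ i).IsHomogeneous 1) (he : ∀ i, HasSymbol (ρ (e i)) (φ i)) {d : ℕ} {P : D}
    (hP : P ∈ ordFiltration c e d) : toPoly g (ρ P 1) ∈ degreeLT d := by
  let f : D →+ MvPolynomial (Fin p) (PowModule g) :=
    { toFun := fun P => toPoly g (ρ P 1)
      map_zero' := by simp
      map_add' := fun P Q => by rw [map_add, LinearMap.add_apply, map_add] }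
  have : ordFiltration c e d ≤ (degreeLT d).comap f := by
    refine (AddSubgroup.closure_le _).2 ?_
    rintro P ⟨r, w, hw, rfl⟩
    change toPoly g (ρ (c r * _) 1) ∈ degreeLT d
    rw [toPoly_coeff_mul hc]
    refine mul_mem_degreeLT (d := d) (isHomogeneous_C _ _) ?_
    have := add_mem (degreeLT_mono hw.le (toPoly_word_sub_mem hφ he w))
      (isHomogeneous_mem_degreeLT hw (isHomogeneous_word hφ w))
    simpa using this
  exact this hP

/-- The part of top degree in `s` of the value at `1` of an operator is the value of its
principal symbol. -/
theorem toPoly_quantize_sub_mem (hc : ∀ r, ρ (c r) =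
      Algebra.lmul ℂ (SymbolModule g) (algebraMap (MvPolynomial (Fin p) R) _ (C r)))
    (hφ : ∀ i, (φ i).IsHomogeneous 1) (he : ∀ i, HasSymbol (ρ (e i)) (φ i)) {d : ℕ}
    {F : MvPolynomial ι R} (hF : F.IsHomogeneous d) :
    toPoly g (ρ (quantize c e F) 1) -
      eval₂Hom (C.comp (algebraMap R (PowModule g))) φ F ∈ degreeLT d := by
  have h1 : eval₂Hom (C.comp (algebraMap R (PowModule g))) φ F = ∑ α ∈ F.support,
      C (algebraMap R (PowModule g) (coeff α F)) * (α.toMultiset.toList.map φ).prod := by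
    rw [coe_eval₂Hom, eval₂_eq]
    refine Finset.sum_congr rfl fun α _ => ?_
    rw [RingHom.comp_apply, ← Multiset.prod_coe, ← Multiset.map_coe, Multiset.coe_toList,
      Finsupp.toMultiset_map, Finsupp.prod_toMultiset,
      Finsupp.prod_mapDomain_index (fun _ => pow_zero _) fun _ _ _ => pow_add _ _ _]
    rfl
  rw [h1, quantize_sum, map_sum, LinearMap.sum_apply, map_sum, ← Finset.sum_sub_distrib]
  refine sum_mem fun α hα => ?_
  have hα' : α.degree = d := by
    by_contra h; exact (mem_support_iff.1 hα) (hF.coeff_eq_zero h)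
  rw [quantize_monomial, toPoly_coeff_mul hc, ← mul_sub]
  have h2 := toPoly_word_sub_mem hφ he α.toMultiset.toList
  rw [length_toList_toMultiset, hα'] at h2
  exact mul_mem_degreeLT (isHomogeneous_C _ _) h2

/-- The principal symbol of an operator annihilating the element `1` is sent to zero. -/
theorem eval₂Hom_eq_zero_of_apply_eq_zero (hc : ∀ r, ρ (c r) =
      Algebra.lmul ℂ (SymbolModule g) (algebraMap (MvPolynomial (Fin p) R) _ (C r)))
    (hφ : ∀ i, (φ i).IsHomogeneous 1) (he : ∀ i, HasSymbol (ρ (e i)) (φ i)) {d : ℕ}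
    {F : MvPolynomial ι R} (hF : F.IsHomogeneous d) {P : D} (hP : ρ P 1 = 0)
    (hPF : P - quantize c e F ∈ ordFiltration c e d) :
    eval₂Hom (C.comp (algebraMap R (PowModule g))) φ F = 0 := by
  have h1 := toPoly_quantize_sub_mem hc hφ he hF
  have h2 := toPoly_mem_degreeLT hc hφ he hPF
  rw [map_sub, LinearMap.sub_apply, hP, zero_sub, map_neg] at h2
  refine eq_zero_of_isHomogeneous_of_mem_degreeLT (d := d) ?_ ?_
  · have := hF.eval₂ (n := 1) (C.comp (algebraMap R (PowModule g))) φ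
      (fun r => isHomogeneous_C _ _) hφ
    simpa using this
  · have := neg_mem (add_mem h1 h2)
    simpa using this

end TopDegree

/-! ### Coordinates adapted to the family of linear forms -/

section Coordinates

variable {n : ℕ} {l : Fin (n + 1) → Module.Dual ℂ (Fin n → ℂ)} (hl : Generic l)

/-- The basis of `ℂⁿ` dual to the forms `l_{k+1}`. -/
def dualVec (k : Fin n) : Fin n → ℂ := constField hl (Fin.succ_ne_zero k)

theorem apply_constField_self {i j : Fin (n + 1)} (hij : i ≠ j) : l i (constField hl hij) = 1 :=
  (hl.existsUnique hij).choose_spec.1.1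

theorem apply_constField_of_ne {i j k : Fin (n + 1)} (hij : i ≠ j) (hi : k ≠ i) (hj : k ≠ j) :
    l k (constField hl hij) = 0 :=
  (hl.existsUnique hij).choose_spec.1.2 k hi hj

theorem eq_constField {i j : Fin (n + 1)} (hij : i ≠ j) {v : Fin n → ℂ} (h1 : l i v = 1)
    (h2 : ∀ k, k ≠ i → k ≠ j → l k v = 0) : v = constField hl hij :=
  (hl.existsUnique hij).choose_spec.2 v ⟨h1, h2⟩

theorem apply_dualVec (i j : Fin n) : l i.succ (dualVec hl j) = if i = j then 1 else 0 := by
  split_ifs with h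
  · subst h; exact apply_constField_self hl _
  · exact apply_constField_of_ne hl _ (fun h' => h (Fin.succ_injective _ h'))
      (Fin.succ_ne_zero _)

/-- Otherwise the `k`-th dual vector could be added to the vector dual to `l 0` in the basis
obtained by omitting `l k.succ`. -/
theorem zero_apply_dualVec_ne_zero (k : Fin n) : l 0 (dualVec hl k) ≠ 0 := by
  intro h
  have hk : (0 : Fin (n + 1)) ≠ k.succ := (Fin.succ_ne_zero k).symm
  have h1 := eq_constField hl hk (v := constField hl hk + dualVec hl k)
    (by rw [map_add, h, add_zero, apply_constField_self])
    (fun m hm hm' => by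
      rw [map_add, apply_constField_of_ne hl hk hm hm', zero_add]
      exact apply_constField_of_ne hl _ hm' hm)
  have h2 : dualVec hl k = 0 := by simpa using h1
  have h3 := apply_dualVec hl k k
  rw [h2, map_zero, if_pos rfl] at h3
  exact zero_ne_one h3

theorem sum_smul_dualVec (v : Fin n → ℂ) : ∑ k : Fin n, l k.succ v • dualVec hl k = v := by
  rcases n with _ | n
  · exact Subsingleton.elim _ _
  set w := ∑ k : Fin (n + 1), l k.succ v • dualVec hl k with hw
  have hlw : ∀ j : Fin (n + 1), l j.succ w = l j.succ v := by
    intro j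
    rw [hw, map_sum]
    simp [apply_dualVec]
  have h1 := eq_constField hl (Fin.succ_ne_zero (0 : Fin (n + 1)))
    (v := dualVec hl 0 + (w - v))
    (by rw [map_add, map_sub, hlw, sub_self, add_zero, apply_dualVec, if_pos rfl])
    (fun m hm hm' => by
      obtain ⟨j, rfl⟩ := Fin.exists_succ_eq.2 hm'
      rw [map_add, map_sub, hlw, sub_self, add_zero, apply_dualVec, if_neg]
      exact fun h => hm (congrArg Fin.succ h))
  have h2 : dualVec hl 0 + (w - v) = dualVec hl 0 := h1
  exact sub_eq_zero.1 (by simpa using h2)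

theorem form_eq_sum (φ : Module.Dual ℂ (Fin n → ℂ)) :
    φ = ∑ k : Fin n, φ (dualVec hl k) • l k.succ := by
  refine LinearMap.ext fun v => ?_
  conv_lhs => rw [← sum_smul_dualVec hl v]
  rw [map_sum, LinearMap.sum_apply]
  refine Finset.sum_congr rfl fun k _ => ?_
  rw [map_smul, LinearMap.smul_apply, smul_eq_mul, smul_eq_mul, mul_comm]

theorem constField_succ_succ {i j : Fin n} (hij : i.succ ≠ j.succ) :
    constField hl hij =
      dualVec hl i - (l 0 (dualVec hl i) / l 0 (dualVec hl j)) • dualVec hl j := by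
  have hne : i ≠ j := fun h => hij (congrArg Fin.succ h)
  symm
  refine eq_constField hl hij ?_ fun k hki hkj => ?_
  · rw [map_sub, map_smul, apply_dualVec, apply_dualVec, if_pos rfl, if_neg hne, smul_zero,
      sub_zero]
  · rw [map_sub, map_smul]
    rcases Fin.eq_zero_or_eq_succ k with rfl | ⟨m, rfl⟩
    · rw [smul_eq_mul, div_mul_cancel₀ _ (zero_apply_dualVec_ne_zero hl j), sub_self]
    · rw [apply_dualVec, apply_dualVec, if_neg (fun h => hki (congrArg Fin.succ h)),
        if_neg (fun h => hkj (congrArg Fin.succ h)), smul_zero, sub_zero]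

end Coordinates

/-! ### Generators of the ring of differential operators -/

section Generators

variable {n p : ℕ} {x₀ : Fin n → ℂ}

theorem linGerm_add (φ ψ : Module.Dual ℂ (Fin n → ℂ)) :
    linGerm x₀ (φ + ψ) = linGerm x₀ φ + linGerm x₀ ψ := rfl

theorem linGerm_smul (z : ℂ) (φ : Module.Dual ℂ (Fin n → ℂ)) :
    linGerm x₀ (z • φ) = z • linGerm x₀ φ := rfl

theorem linGerm_sum {κ : Type*} (s : Finset κ) (φ : κ → Module.Dual ℂ (Fin n → ℂ)) :
    linGerm x₀ (∑ i ∈ s, φ i) = ∑ i ∈ s, linGerm x₀ (φ i) := by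
  classical
  induction s using Finset.induction_on with
  | empty => rfl
  | insert a s ha ih => rw [Finset.sum_insert ha, Finset.sum_insert ha, linGerm_add, ih]

theorem partialDeriv_linGerm (m : Fin n) (φ : Module.Dual ℂ (Fin n → ℂ)) :
    partialDeriv x₀ m (linGerm x₀ φ) = algebraMap ℂ (Stalk x₀) (φ (Pi.single m 1)) := by
  unfold partialDeriv linGerm
  rw [dirDeriv_germ]
  change _ = germ (fun _ => φ (Pi.single m 1)) analyticAt_const
  rw [germ_eq_iff]
  refine Filter.Eventually.of_forall fun x => ?_
  change fderiv ℂ (LinearMap.toContinuousLinearMap φ) x _ = _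
  rw [ContinuousLinearMap.fderiv]
  rfl

/-- The derivation of germs given by the constant vector field `u`. -/
def fieldDer (x₀ u : Fin n → ℂ) : Derivation ℂ (Stalk x₀) (Stalk x₀) :=
  ∑ m, u m • partialDeriv x₀ m

theorem fieldDer_apply (u : Fin n → ℂ) (a : Stalk x₀) :
    fieldDer x₀ u a = ∑ m, u m • partialDeriv x₀ m a := by
  unfold fieldDer
  rw [← Derivation.coeFnAddMonoidHom_apply, map_sum, Finset.sum_apply]
  rfl

theorem apply_eq_sum (φ : Module.Dual ℂ (Fin n → ℂ)) (u : Fin n → ℂ) :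
    φ u = ∑ m, u m * φ (Pi.single m 1) := by
  conv_lhs => rw [pi_eq_sum_univ' u, map_sum]
  refine Finset.sum_congr rfl fun m _ => ?_
  rw [map_smul, smul_eq_mul]

theorem fieldDer_linGerm (u : Fin n → ℂ) (φ : Module.Dual ℂ (Fin n → ℂ)) :
    fieldDer x₀ u (linGerm x₀ φ) = algebraMap ℂ (Stalk x₀) (φ u) := by
  rw [fieldDer_apply, apply_eq_sum φ u, map_sum]
  refine Finset.sum_congr rfl fun m _ => ?_
  rw [partialDeriv_linGerm, Algebra.smul_def, map_mul]

/-- Germs of functions as operators of order zero. -/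
def coeffHom (p : ℕ) (x₀ : Fin n → ℂ) : Stalk x₀ →+* DS p x₀ :=
  (DiffOp.coeff (polyPartial p x₀)).toRingHom.comp MvPolynomial.C

theorem coeffHom_algebraMap (z : ℂ) :
    coeffHom p x₀ (algebraMap ℂ (Stalk x₀) z) = algebraMap ℂ (DS p x₀) z :=
  (DiffOp.coeff (polyPartial p x₀)).commutes z

theorem coeffHom_linGerm (φ : Module.Dual ℂ (Fin n → ℂ)) :
    coeffHom p x₀ (linGerm x₀ φ) = opLin p x₀ φ := rfl

theorem der_mul_coeff (m : Fin n) (a : MvPolynomial (Fin p) (Stalk x₀)) :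
    DiffOp.der (polyPartial p x₀) m * DiffOp.coeff _ a =
      DiffOp.coeff _ a * DiffOp.der _ m + DiffOp.coeff _ (polyPartial p x₀ m a) := by
  have h := DiffOp.mk_rel (DiffOpRel.leibniz (δ := polyPartial p x₀) m a)
  rwa [map_mul, map_add, map_mul] at h

theorem der_mul_der (i j : Fin n) :
    DiffOp.der (polyPartial p x₀) i * DiffOp.der _ j = DiffOp.der _ j * DiffOp.der _ i := by
  have h := DiffOp.mk_rel (DiffOpRel.comm (δ := polyPartial p x₀) i j)
  rwa [map_mul, map_mul] at h

theorem opField_mul_coeffHom (u : Fin n → ℂ) (a : Stalk x₀) :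
    opField p x₀ u * coeffHom p x₀ a =
      coeffHom p x₀ a * opField p x₀ u + coeffHom p x₀ (fieldDer x₀ u a) := by
  unfold opField
  rw [fieldDer_apply, map_sum, Finset.sum_mul, Finset.mul_sum, ← Finset.sum_add_distrib]
  refine Finset.sum_congr rfl fun m _ => ?_
  have h : DiffOp.der (polyPartial p x₀) m * coeffHom p x₀ a = coeffHom p x₀ a * DiffOp.der _ m +
      coeffHom p x₀ (partialDeriv x₀ m a) := by
    have := der_mul_coeff (p := p) m (MvPolynomial.C a)
    unfold polyPartial at this
    rwa [polyDer_C] at this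
  rw [smul_mul_assoc, h, smul_add, mul_smul_comm, Algebra.smul_def (u m) (partialDeriv x₀ m a),
    map_mul, coeffHom_algebraMap, ← Algebra.smul_def]

theorem opField_mul_opLin (u : Fin n → ℂ) (φ : Module.Dual ℂ (Fin n → ℂ)) :
    opField p x₀ u * opLin p x₀ φ = opLin p x₀ φ * opField p x₀ u + algebraMap ℂ _ (φ u) := by
  rw [← coeffHom_linGerm, opField_mul_coeffHom, fieldDer_linGerm, coeffHom_algebraMap]

theorem opField_comm (u v : Fin n → ℂ) :
    opField p x₀ u * opField p x₀ v = opField p x₀ v * opField p x₀ u := by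
  unfold opField
  rw [Finset.sum_mul_sum, Finset.sum_mul_sum, Finset.sum_comm]
  refine Finset.sum_congr rfl fun i _ => Finset.sum_congr rfl fun j _ => ?_
  rw [smul_mul_smul_comm, smul_mul_smul_comm, der_mul_der, mul_comm (u j)]

theorem opField_sub (u v : Fin n → ℂ) :
    opField p x₀ (u - v) = opField p x₀ u - opField p x₀ v := by
  unfold opField
  rw [← Finset.sum_sub_distrib]
  exact Finset.sum_congr rfl fun m _ => by rw [Pi.sub_apply, sub_smul]

theorem opField_smul (z : ℂ) (u : Fin n → ℂ) : opField p x₀ (z • u) = z • opField p x₀ u := by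
  unfold opField
  rw [Finset.smul_sum]
  exact Finset.sum_congr rfl fun m _ => by rw [Pi.smul_apply, smul_eq_mul, mul_smul]

theorem opField_sum {κ : Type*} (s : Finset κ) (u : κ → Fin n → ℂ) :
    opField p x₀ (∑ i ∈ s, u i) = ∑ i ∈ s, opField p x₀ (u i) := by
  unfold opField
  rw [Finset.sum_comm]
  exact Finset.sum_congr rfl fun m _ => by rw [Finset.sum_apply, Finset.sum_smul]

theorem opField_single (m : Fin n) : opField p x₀ (Pi.single m 1) = DiffOp.der _ m := by
  unfold opField
  rw [Finset.sum_eq_single m]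
  · rw [Pi.single_eq_same, one_smul]
  · intro j _ hj
    rw [Pi.single_eq_of_ne hj, zero_smul]
  · simp

theorem opLin_mul_comm (φ ψ : Module.Dual ℂ (Fin n → ℂ)) :
    opLin p x₀ φ * opLin p x₀ ψ = opLin p x₀ ψ * opLin p x₀ φ := by
  rw [← coeffHom_linGerm, ← coeffHom_linGerm, ← map_mul, ← map_mul, mul_comm]

theorem opLin_smul (z : ℂ) (φ : Module.Dual ℂ (Fin n → ℂ)) :
    opLin p x₀ (z • φ) = z • opLin p x₀ φ := by
  rw [← coeffHom_linGerm, linGerm_smul, Algebra.smul_def, map_mul, coeffHom_algebraMap,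
    coeffHom_linGerm, ← Algebra.smul_def]

theorem opLin_sum {κ : Type*} (s : Finset κ) (φ : κ → Module.Dual ℂ (Fin n → ℂ)) :
    opLin p x₀ (∑ i ∈ s, φ i) = ∑ i ∈ s, opLin p x₀ (φ i) := by
  rw [← coeffHom_linGerm, linGerm_sum, map_sum]
  rfl

/-- Induction over the ring of differential operators: it is generated by the germs of functions,
the variables `s_k` and the partial derivatives. -/
theorem mem_of_generators (A : Subalgebra ℂ (DS p x₀)) (h1 : ∀ a, coeffHom p x₀ a ∈ A)
    (h2 : ∀ k, opS x₀ k ∈ A) (h3 : ∀ m, DiffOp.der _ m ∈ A) (P : DS p x₀) : P ∈ A := by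
  obtain ⟨F, rfl⟩ := RingQuot.mkAlgHom_surjective ℂ (DiffOpRel (polyPartial p x₀)) P
  induction F using FreeAlgebra.induction with
  | grade0 z =>
    rw [AlgHom.commutes]
    exact A.algebraMap_mem z
  | grade1 x =>
    rcases x with a | m
    · change DiffOp.coeff (polyPartial p x₀) a ∈ A
      induction a using MvPolynomial.induction_on with
      | C a => exact h1 a
      | add a b ha hb => rw [map_add]; exact A.add_mem ha hb
      | mul_X a k ha => rw [map_mul]; exact A.mul_mem ha (h2 k)
    · exact h3 m
  | mul F G hF hG => rw [map_mul]; exact A.mul_mem hF hG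
  | add F G hF hG => rw [map_add]; exact A.add_mem hF hG

/-- The variables `s_k` are central. -/
theorem opS_mul_comm (k : Fin p) (P : DS p x₀) : opS x₀ k * P = P * opS x₀ k := by
  have hc : ∀ a : MvPolynomial (Fin p) (Stalk x₀),
      opS x₀ k * DiffOp.coeff _ a = DiffOp.coeff _ a * opS x₀ k := fun a => by
    unfold opS
    rw [← map_mul, ← map_mul, mul_comm]
  have h := mem_of_generators (Subalgebra.centralizer ℂ {opS x₀ k})
    (fun a => Subalgebra.mem_centralizer_iff ℂ |>.2 (by rintro _ rfl; exact hc _))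
    (fun j => Subalgebra.mem_centralizer_iff ℂ |>.2 (by rintro _ rfl; exact hc _))
    (fun m => Subalgebra.mem_centralizer_iff ℂ |>.2 (by
      rintro _ rfl
      unfold opS
      rw [der_mul_coeff]
      unfold polyPartial
      rw [polyDer_X, map_zero, add_zero])) P
  exact (Subalgebra.mem_centralizer_iff ℂ).1 h _ rfl

end Generators

section LogGenerators

variable {n : ℕ} {l : Fin (n + 1) → Module.Dual ℂ (Fin n → ℂ)} (hl : Generic l) (x₀ : Fin n → ℂ)

/-- The operator `l_{k+1} ∂_k - s_{k+1}`, where `∂_k` is the `k`-th field of the dual basis. -/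
def logOp (k : Fin n) : DS (n + 1) x₀ :=
  opLin (n + 1) x₀ (l k.succ) * opField (n + 1) x₀ (dualVec hl k) - opS x₀ k.succ

/-- The generators of the ring of differential operators over the germs of functions. The last
ones are scaled so that their symbols are `l_{k+1} s_0 / l_0`. -/
def genOp : GenIdx n → DS (n + 1) x₀
  | none => opETilde x₀
  | some (Sum.inl k) => opField (n + 1) x₀ (dualVec hl k)
  | some (Sum.inr k) => (l 0 (dualVec hl k))⁻¹ • logOp hl x₀ k

theorem opField_eq_sum (v : Fin n → ℂ) : opField (n + 1) x₀ v =
    ∑ k : Fin n, l k.succ v • opField (n + 1) x₀ (dualVec hl k) := by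
  conv_lhs => rw [← sum_smul_dualVec hl v, opField_sum]
  exact Finset.sum_congr rfl fun k _ => opField_smul _ _

theorem opEuler_eq_sum : opEuler (n + 1) x₀ =
    ∑ k : Fin n, opLin (n + 1) x₀ (l k.succ) * opField (n + 1) x₀ (dualVec hl k) := by
  have h1 : ∀ k : Fin n, opLin (n + 1) x₀ (l k.succ) =
      ∑ m, l k.succ (Pi.single m 1) • opLin (n + 1) x₀ (LinearMap.proj m) := by
    intro k
    have : l k.succ = ∑ m, l k.succ (Pi.single m 1) • (LinearMap.proj m : (Fin n → ℂ) →ₗ[ℂ] ℂ) := by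
      refine LinearMap.ext fun v => ?_
      rw [LinearMap.sum_apply, apply_eq_sum (l k.succ) v]
      exact Finset.sum_congr rfl fun m _ => mul_comm _ _
    conv_lhs => rw [this, opLin_sum]
    exact Finset.sum_congr rfl fun m _ => opLin_smul _ _
  unfold opEuler
  simp only [h1, Finset.sum_mul]
  rw [Finset.sum_comm]
  refine Finset.sum_congr rfl fun m _ => ?_
  rw [← opField_single, opField_eq_sum hl, Finset.mul_sum]
  refine Finset.sum_congr rfl fun k _ => ?_
  rw [mul_smul_comm, smul_mul_assoc]

/-- The variable `s_0` is a combination of `Ẽ` and of the operators `l_{k+1} ∂_k - s_{k+1}`. -/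
theorem opETilde_eq_sum : opETilde x₀ = ∑ k, logOp hl x₀ k - opS x₀ 0 := by
  unfold opETilde logOp
  rw [opEuler_eq_sum hl, Fin.sum_univ_succ, Finset.sum_sub_distrib]
  abel

theorem smul_genOp (k : Fin n) :
    l 0 (dualVec hl k) • genOp hl x₀ (some (Sum.inr k)) = logOp hl x₀ k :=
  smul_inv_smul₀ (zero_apply_dualVec_ne_zero hl k) _

/-- The operator `Ũ_{i+1,j+1}` is a scalar multiple of `l_{j+1} η_i - l_{i+1} η_j`, where `η_k` is
the generator with symbol `l_{k+1} s_0 / l_0`. -/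
theorem opUTilde_eq {i j : Fin n} (hij : i.succ ≠ j.succ) :
    opUTilde hl x₀ hij = l 0 (dualVec hl i) •
      (opLin (n + 1) x₀ (l j.succ) * genOp hl x₀ (some (Sum.inr i)) -
        opLin (n + 1) x₀ (l i.succ) * genOp hl x₀ (some (Sum.inr j))) := by
  have hne : i ≠ j := fun h => hij (congrArg Fin.succ h)
  have ha := zero_apply_dualVec_ne_zero hl i
  unfold opUTilde genOp logOp
  rw [constField_succ_succ, opField_sub, opField_smul, map_sub, map_smul, apply_dualVec,
    apply_dualVec, if_pos rfl, if_neg (Ne.symm hne), zero_sub, smul_eq_mul, mul_one, smul_sub,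
    mul_smul_comm, smul_smul, mul_smul_comm, smul_smul, mul_inv_cancel₀ ha, one_smul,
    ← div_eq_mul_inv, mul_sub, mul_sub, mul_sub, mul_smul_comm, ← mul_assoc, ← mul_assoc,
    opLin_mul_comm (l j.succ), neg_smul, smul_sub]
  abel

theorem commute_opS (k : Fin (n + 1)) (P : DS (n + 1) x₀) : Commute (opS x₀ k) P :=
  opS_mul_comm k P

theorem logOp_mul_opField_sub (j k : Fin n) :
    logOp hl x₀ j * opField (n + 1) x₀ (dualVec hl k) -
      opField (n + 1) x₀ (dualVec hl k) * logOp hl x₀ j =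
      if j = k then -opField (n + 1) x₀ (dualVec hl k) else 0 := by
  have h1 := opField_mul_opLin (p := n + 1) (x₀ := x₀) (dualVec hl k) (l j.succ)
  have h2 := opField_comm (p := n + 1) (x₀ := x₀) (dualVec hl j) (dualVec hl k)
  unfold logOp
  rw [sub_mul, mul_sub, opS_mul_comm, mul_assoc, h2, ← mul_assoc (opField _ _ _) (opLin _ _ _), h1,
    add_mul, mul_assoc, apply_dualVec]
  split_ifs with h
  · subst h
    rw [map_one, one_mul]
    abel
  · rw [map_zero, zero_mul]
    abel

theorem logOp_commute (j k : Fin n) : Commute (logOp hl x₀ j) (logOp hl x₀ k) := by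
  rcases eq_or_ne j k with rfl | h
  · exact Commute.refl _
  have key : ∀ {i m : Fin n}, i ≠ m → Commute (opField (n + 1) x₀ (dualVec hl i))
      (opLin (n + 1) x₀ (l m.succ)) := fun {i m} him => by
    have := opField_mul_opLin (p := n + 1) (x₀ := x₀) (dualVec hl i) (l m.succ)
    rw [apply_dualVec, if_neg him.symm, map_zero, add_zero] at this
    exact this
  have h1 : Commute (opLin (n + 1) x₀ (l j.succ)) (opLin (n + 1) x₀ (l k.succ)) :=
    opLin_mul_comm _ _
  have h2 : Commute (opField (n + 1) x₀ (dualVec hl j)) (opField (n + 1) x₀ (dualVec hl k)) :=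
    opField_comm _ _
  unfold logOp
  refine Commute.sub_left (Commute.sub_right ?_ (commute_opS _ _ _).symm) (commute_opS _ _ _)
  exact (h1.mul_right (key h.symm).symm).mul_left ((key h).mul_right h2)

theorem exists_genOp_mul_coeffHom (i : GenIdx n) (r : Stalk x₀) :
    ∃ r', genOp hl x₀ i * coeffHom (n + 1) x₀ r =
      coeffHom (n + 1) x₀ r * genOp hl x₀ i + coeffHom (n + 1) x₀ r' := by
  have hlog : ∀ k, ∃ r', logOp hl x₀ k * coeffHom (n + 1) x₀ r =
      coeffHom (n + 1) x₀ r * logOp hl x₀ k + coeffHom (n + 1) x₀ r' := by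
    intro k
    refine ⟨linGerm x₀ (l k.succ) * fieldDer x₀ (dualVec hl k) r, ?_⟩
    unfold logOp
    rw [sub_mul, mul_sub, opS_mul_comm, mul_assoc, opField_mul_coeffHom, mul_add, ← mul_assoc,
      ← mul_assoc, ← coeffHom_linGerm, ← map_mul, ← map_mul, ← map_mul,
      mul_comm r]
    abel
  choose t ht using hlog
  rcases i with _ | k | k
  · refine ⟨∑ k, t k, ?_⟩
    change opETilde x₀ * _ = _ * opETilde x₀ + _
    rw [opETilde_eq_sum hl, sub_mul, mul_sub, opS_mul_comm, Finset.sum_mul, Finset.mul_sum,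
      Finset.sum_congr rfl fun k _ => ht k, Finset.sum_add_distrib, map_sum]
    abel
  · exact ⟨_, opField_mul_coeffHom _ _⟩
  · refine ⟨(l 0 (dualVec hl k))⁻¹ • t k, ?_⟩
    unfold genOp
    rw [smul_mul_assoc, ht, smul_add, mul_smul_comm, Algebra.smul_def _ (t k), map_mul,
      coeffHom_algebraMap, ← Algebra.smul_def]

theorem genOp_mem_ordFiltration (i : GenIdx n) :
    genOp hl x₀ i ∈ ordFiltration (coeffHom (n + 1) x₀) (genOp hl x₀) 2 := by
  have := word_mem_ordFiltration (c := coeffHom (n + 1) x₀) (e := genOp hl x₀) 1 (w := [i])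
    (d := 2) (by simp)
  simpa using this

theorem smul_mem_ordFiltration (z : ℂ) {d : ℕ} {P : DS (n + 1) x₀}
    (hP : P ∈ ordFiltration (coeffHom (n + 1) x₀) (genOp hl x₀) d) :
    z • P ∈ ordFiltration (coeffHom (n + 1) x₀) (genOp hl x₀) d := by
  rw [Algebra.smul_def, ← coeffHom_algebraMap]
  exact coeff_mul_mem_ordFiltration _ hP

theorem genOp_bracket_mem (i j : GenIdx n) :
    genOp hl x₀ i * genOp hl x₀ j - genOp hl x₀ j * genOp hl x₀ i ∈
      ordFiltration (coeffHom (n + 1) x₀) (genOp hl x₀) 2 := by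
  have hnone : genOp hl x₀ none = ∑ k, logOp hl x₀ k - opS x₀ 0 := opETilde_eq_sum hl x₀
  have hf := fun k => genOp_mem_ordFiltration hl x₀ (some (Sum.inl k))
  have hlf : ∀ j k, logOp hl x₀ j * opField (n + 1) x₀ (dualVec hl k) -
      opField (n + 1) x₀ (dualVec hl k) * logOp hl x₀ j ∈
      ordFiltration (coeffHom (n + 1) x₀) (genOp hl x₀) 2 := by
    intro j k
    rw [logOp_mul_opField_sub]
    split_ifs
    · exact neg_mem (hf k)
    · exact zero_mem _
  have hgf : ∀ j k, genOp hl x₀ (some (Sum.inr j)) * genOp hl x₀ (some (Sum.inl k)) -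
      genOp hl x₀ (some (Sum.inl k)) * genOp hl x₀ (some (Sum.inr j)) ∈
      ordFiltration (coeffHom (n + 1) x₀) (genOp hl x₀) 2 := by
    intro j k
    unfold genOp
    rw [smul_mul_assoc, mul_smul_comm, ← smul_sub]
    exact smul_mem_ordFiltration hl x₀ _ (hlf j k)
  have hef : ∀ k, genOp hl x₀ none * genOp hl x₀ (some (Sum.inl k)) -
      genOp hl x₀ (some (Sum.inl k)) * genOp hl x₀ none ∈
      ordFiltration (coeffHom (n + 1) x₀) (genOp hl x₀) 2 := by
    intro k
    rw [hnone, sub_mul, mul_sub, opS_mul_comm, sub_sub_sub_cancel_right,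
      Finset.sum_mul, Finset.mul_sum, ← Finset.sum_sub_distrib]
    exact sum_mem fun j _ => hlf j k
  have hcomm : ∀ i j, Commute (genOp hl x₀ i) (genOp hl x₀ j) →
      genOp hl x₀ i * genOp hl x₀ j - genOp hl x₀ j * genOp hl x₀ i ∈
      ordFiltration (coeffHom (n + 1) x₀) (genOp hl x₀) 2 := by
    intro i j h
    rw [h.eq, sub_self]
    exact zero_mem _
  have heg : ∀ k, Commute (genOp hl x₀ none) (genOp hl x₀ (some (Sum.inr k))) := by
    intro k
    rw [hnone]
    exact ((Commute.sum_left _ _ _ fun j _ => logOp_commute hl x₀ j k).sub_left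
      (commute_opS _ _ _)).smul_right _
  rcases i with _ | i | i <;> rcases j with _ | j | j
  · exact hcomm _ _ (Commute.refl _)
  · exact hef j
  · exact hcomm _ _ (heg j)
  · rw [← neg_sub]; exact neg_mem (hef i)
  · exact hcomm _ _ (opField_comm _ _)
  · rw [← neg_sub]; exact neg_mem (hgf j i)
  · exact hcomm _ _ (heg i).symm
  · exact hgf i j
  · exact hcomm _ _ (((logOp_commute hl x₀ i j).smul_left _).smul_right _)

/-- The union of the steps of the order filtration, as a subalgebra. -/
def finiteOrder : Subalgebra ℂ (DS (n + 1) x₀) where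
  carrier := {P | ∃ d, P ∈ ordFiltration (coeffHom (n + 1) x₀) (genOp hl x₀) d}
  add_mem' := by
    rintro P Q ⟨d, hP⟩ ⟨d', hQ⟩
    exact ⟨max d d', add_mem (ordFiltration_mono (le_max_left _ _) hP)
      (ordFiltration_mono (le_max_right _ _) hQ)⟩
  mul_mem' := by
    rintro P Q ⟨d, hP⟩ ⟨d', hQ⟩
    refine ⟨d' + d, map_mem_ordFiltration_of_words (AddMonoidHom.mulRight Q) (fun r w hw => ?_) hP⟩
    rw [AddMonoidHom.mulRight_apply, mul_assoc]
    exact coeff_mul_mem_ordFiltration r (ordFiltration_mono (Nat.add_le_add_left hw.le _)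
      (word_mul_mem_ordFiltration (exists_genOp_mul_coeffHom hl x₀) w hQ))
  algebraMap_mem' z := by
    refine ⟨1, ?_⟩
    have := word_mem_ordFiltration (c := coeffHom (n + 1) x₀) (e := genOp hl x₀)
      (algebraMap ℂ _ z) (w := []) (d := 1) (by simp)
    rwa [coeffHom_algebraMap, List.map_nil, List.prod_nil, mul_one] at this

theorem exists_mem_ordFiltration (P : DS (n + 1) x₀) :
    ∃ d, P ∈ ordFiltration (coeffHom (n + 1) x₀) (genOp hl x₀) d := by
  have hc : ∀ a, coeffHom (n + 1) x₀ a ∈ finiteOrder hl x₀ := fun a => by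
    refine ⟨1, ?_⟩
    have := word_mem_ordFiltration (c := coeffHom (n + 1) x₀) (e := genOp hl x₀)
      a (w := []) (d := 1) (by simp)
    rwa [List.map_nil, List.prod_nil, mul_one] at this
  have hg : ∀ i, genOp hl x₀ i ∈ finiteOrder hl x₀ := fun i =>
    ⟨2, genOp_mem_ordFiltration hl x₀ i⟩
  have hf : ∀ k, opField (n + 1) x₀ (dualVec hl k) ∈ finiteOrder hl x₀ := fun k =>
    hg (some (Sum.inl k))
  have hlog : ∀ k, logOp hl x₀ k ∈ finiteOrder hl x₀ := fun k => by
    rw [← smul_genOp]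
    exact Subalgebra.smul_mem _ (hg _) _
  refine mem_of_generators (finiteOrder hl x₀) hc (fun k => ?_) (fun m => ?_) P
  · rcases Fin.eq_zero_or_eq_succ k with rfl | ⟨k, rfl⟩
    · have h := sub_mem (sum_mem fun k (_ : k ∈ Finset.univ) => hlog k) (hg none)
      change _ - opETilde x₀ ∈ _ at h
      rwa [opETilde_eq_sum hl, sub_sub_cancel] at h
    · have h := sub_mem (mul_mem (hc (linGerm x₀ (l k.succ))) (hf k)) (hlog k)
      rwa [coeffHom_linGerm, logOp, sub_sub_cancel] at h
  · rw [← opField_single, opField_eq_sum hl]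
    exact sum_mem fun k _ => Subalgebra.smul_mem _ (hf k) _

end LogGenerators

/-! ### The annihilator -/

section Annihilator

open MvPolynomial

variable {n : ℕ} {l : Fin (n + 1) → Module.Dual ℂ (Fin n → ℂ)} (x₀ : Fin n → ℂ)

/-- The action of operators on `R[s, 1/(l_0⋯l_n)] · l_0^{s_0}⋯l_n^{s_n}`, where `R` is the ring
of germs. -/
def actHom (l : Fin (n + 1) → Module.Dual ℂ (Fin n → ℂ)) (x₀ : Fin n → ℂ) :
    DS (n + 1) x₀ →+* Module.End ℂ (SymbolModule fun k => linGerm x₀ (l k)) :=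
  (powAction (fun k => C (linGerm x₀ (l k))) X (polyPartial (n + 1) x₀)
    (fun _ _ a => polyDer_comm (dirDeriv_comm _ _) a) (fun _ k => polyDer_X _ k)).toRingHom

theorem mem_Ann_iff {P : DS (n + 1) x₀} : P ∈ Ann l x₀ ↔ actHom l x₀ P 1 = 0 := Iff.rfl

theorem actHom_coeff (a : MvPolynomial (Fin (n + 1)) (Stalk x₀)) :
    actHom l x₀ (DiffOp.coeff _ a) = Algebra.lmul ℂ (SymbolModule fun k => linGerm x₀ (l k))
      (algebraMap (MvPolynomial (Fin (n + 1)) (Stalk x₀)) _ a) :=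
  DiffOp.lift_coeff _ _ _ _ _

theorem actHom_der (m : Fin n) : actHom l x₀ (DiffOp.der _ m) =
    twistedDer (fun k => C (linGerm x₀ (l k))) X (polyDer (partialDeriv x₀ m)) :=
  DiffOp.lift_der _ _ _ _ _

variable {x₀}

theorem HasSymbol.coeffHom_mul {P : DS (n + 1) x₀}
    {φ : MvPolynomial (Fin (n + 1)) (PowModule fun k => linGerm x₀ (l k))}
    (hP : HasSymbol (actHom l x₀ P) φ) (a : Stalk x₀) :
    HasSymbol (actHom l x₀ (coeffHom (n + 1) x₀ a * P)) (C (algebraMap _ _ a) * φ) := by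
  rw [map_mul]
  have h := actHom_coeff (l := l) x₀ (C a)
  change actHom l x₀ (coeffHom (n + 1) x₀ a) = _ at h
  rw [h]
  exact hP.lmul_C a

theorem HasSymbol.smul_op {P : DS (n + 1) x₀}
    {φ : MvPolynomial (Fin (n + 1)) (PowModule fun k => linGerm x₀ (l k))}
    (hP : HasSymbol (actHom l x₀ P) φ) (z : ℂ) :
    HasSymbol (actHom l x₀ (z • P)) (C (algebraMap _ _ (algebraMap ℂ (Stalk x₀) z)) * φ) := by
  rw [Algebra.smul_def, ← coeffHom_algebraMap]
  exact hP.coeffHom_mul _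

theorem hasSymbol_opS (k : Fin (n + 1)) : HasSymbol (actHom l x₀ (opS x₀ k)) (X k) := by
  unfold opS
  rw [actHom_coeff]
  exact hasSymbol_lmul_X k

theorem hasSymbol_opField (u : Fin n → ℂ) : HasSymbol (actHom l x₀ (opField (n + 1) x₀ u))
    (∑ k, C (algebraMap _ (PowModule fun k => linGerm x₀ (l k)) (algebraMap ℂ (Stalk x₀) (l k u)) *
      invFactor (fun k => linGerm x₀ (l k)) k) * X k) := by
  have h1 : ∀ m ∈ (Finset.univ : Finset (Fin n)),
      HasSymbol (actHom l x₀ (u m • DiffOp.der _ m)) _ :=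
    fun m _ => by
      have h := hasSymbol_twistedDer (g := fun k => linGerm x₀ (l k)) (partialDeriv x₀ m)
      rw [← actHom_der] at h
      exact h.smul_op (u m)
  have h2 := HasSymbol.sum Finset.univ h1
  rw [← map_sum] at h2
  unfold opField
  convert h2 using 1
  simp only [Finset.mul_sum]
  rw [Finset.sum_comm]
  refine Finset.sum_congr rfl fun k _ => ?_
  rw [apply_eq_sum (l k) u, map_sum, map_sum, Finset.sum_mul, map_sum, Finset.sum_mul]
  refine Finset.sum_congr rfl fun m _ => ?_
  rw [partialDeriv_linGerm]
  simp only [map_mul]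
  ring

variable (hl : Generic l) (x₀)

/-- The symbols of the generators for the family `l` of linear forms. -/
def formSymbol : GenIdx n → MvPolynomial (Fin (n + 1)) (PowModule fun k => linGerm x₀ (l k)) :=
  genSymbol (fun k => linGerm x₀ (l k.succ)) (fun k => algebraMap ℂ _ (l 0 (dualVec hl k)))
    (fun k => invFactor (fun k => linGerm x₀ (l k)) k.succ)
    (invFactor (fun k => linGerm x₀ (l k)) 0)

theorem isHomogeneous_formSymbol (i : GenIdx n) : (formSymbol x₀ hl i).IsHomogeneous 1 := by
  rcases i with _ | k | k
  · exact isHomogeneous_zero _ _ _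
  · exact (isHomogeneous_C_mul_X _ _).add (isHomogeneous_C_mul_X _ _)
  · exact isHomogeneous_C_mul_X _ _

theorem hasSymbol_dualField (k : Fin n) :
    HasSymbol (actHom l x₀ (opField (n + 1) x₀ (dualVec hl k)))
      (formSymbol x₀ hl (some (Sum.inl k))) := by
  convert hasSymbol_opField (l := l) (x₀ := x₀) (dualVec hl k) using 1
  rw [Fin.sum_univ_succ, Finset.sum_eq_single k]
  · rw [apply_dualVec, if_pos rfl, map_one, map_one, one_mul]
    exact add_comm _ _
  · intro j _ hj
    rw [apply_dualVec, if_neg hj, map_zero, map_zero, zero_mul, map_zero, zero_mul]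
  · simp

theorem hasSymbol_logOp (k : Fin n) : HasSymbol (actHom l x₀ (logOp hl x₀ k))
    (C (algebraMap _ _ (algebraMap ℂ (Stalk x₀) (l 0 (dualVec hl k)))) *
      formSymbol x₀ hl (some (Sum.inr k))) := by
  unfold logOp
  rw [map_sub, ← coeffHom_linGerm]
  convert ((hasSymbol_dualField x₀ hl k).coeffHom_mul (linGerm x₀ (l k.succ))).sub
    (hasSymbol_opS k.succ) using 1
  have h : (C (algebraMap _ (PowModule fun k => linGerm x₀ (l k)) (linGerm x₀ (l k.succ))) :
      MvPolynomial (Fin (n + 1)) _) * C (invFactor (fun k => linGerm x₀ (l k)) k.succ) = 1 := by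
    rw [← C_mul, mul_invFactor (fun k => linGerm x₀ (l k)), C_1]
  simp only [formSymbol, genSymbol, map_mul]
  linear_combination (-X k.succ) * h

theorem hasSymbol_genOp (i : GenIdx n) :
    HasSymbol (actHom l x₀ (genOp hl x₀ i)) (formSymbol x₀ hl i) := by
  rcases i with _ | k | k
  · change HasSymbol (actHom l x₀ (opETilde x₀)) _
    rw [opETilde_eq_sum hl, map_sub, map_sum]
    convert (HasSymbol.sum Finset.univ fun k _ => hasSymbol_logOp x₀ hl k).sub
      (hasSymbol_opS 0) using 1
    have h : (C (algebraMap _ (PowModule fun k => linGerm x₀ (l k)) (linGerm x₀ (l 0))) :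
        MvPolynomial (Fin (n + 1)) _) * C (invFactor (fun k => linGerm x₀ (l k)) 0) = 1 := by
      rw [← C_mul, mul_invFactor (fun k => linGerm x₀ (l k)), C_1]
    have h0 : linGerm x₀ (l 0) =
        ∑ k : Fin n, algebraMap ℂ _ (l 0 (dualVec hl k)) * linGerm x₀ (l k.succ) := by
      conv_lhs => rw [form_eq_sum hl (l 0), linGerm_sum]
      exact Finset.sum_congr rfl fun k _ => by rw [linGerm_smul, Algebra.smul_def]
    have h1 : ∑ k : Fin n, C (algebraMap _ (PowModule fun k => linGerm x₀ (l k))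
          (algebraMap ℂ (Stalk x₀) (l 0 (dualVec hl k)))) *
        formSymbol x₀ hl (some (Sum.inr k)) =
        C (algebraMap _ _ (linGerm x₀ (l 0))) *
          C (invFactor (fun k => linGerm x₀ (l k)) 0) * X 0 := by
      conv_rhs => rw [h0, map_sum, map_sum, Finset.sum_mul, Finset.sum_mul]
      refine Finset.sum_congr rfl fun k _ => ?_
      simp only [formSymbol, genSymbol, map_mul]
      ring
    rw [h1, h, one_mul, sub_self]
    rfl
  · exact hasSymbol_dualField x₀ hl k
  · change HasSymbol (actHom l x₀ (_ • logOp hl x₀ k)) _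
    convert (hasSymbol_logOp x₀ hl k).smul_op (l 0 (dualVec hl k))⁻¹ using 1
    rw [← mul_assoc, ← C_mul, ← map_mul, ← map_mul,
      inv_mul_cancel₀ (zero_apply_dualVec_ne_zero hl k), map_one, map_one, map_one, one_mul]

include hl in
theorem algebraMap_powModule_injective (hn : 0 < n) :
    Function.Injective (algebraMap (Stalk x₀) (PowModule fun k => linGerm x₀ (l k))) := by
  have h : ∏ k, linGerm x₀ (l k) ∈ nonZeroDivisors (Stalk x₀) := by
    refine prod_mem fun k _ => linGerm_mem_nonZeroDivisors fun hk => ?_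
    rcases Fin.eq_zero_or_eq_succ k with rfl | ⟨k, rfl⟩
    · exact zero_apply_dualVec_ne_zero hl ⟨0, hn⟩ (by rw [hk]; rfl)
    · have := apply_dualVec hl k k
      rw [hk, if_pos rfl] at this
      exact zero_ne_one this
  exact IsLocalization.injective _ (Submonoid.powers_le.2 h)

include hl in
theorem mem_Ann_of_hasSymbol_zero {P : DS (n + 1) x₀} (hn : 0 < n)
    (hP : HasSymbol (actHom l x₀ P) 0) : P ∈ Ann l x₀ := by
  rw [mem_Ann_iff]
  refine toPoly_injective (algebraMap_powModule_injective x₀ hl hn) ?_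
  rw [hP.1, map_zero]

theorem hasSymbol_opUTilde {i j : Fin n} (hij : i.succ ≠ j.succ) :
    HasSymbol (actHom l x₀ (opUTilde hl x₀ hij)) 0 := by
  have h : HasSymbol _ _ := ((hasSymbol_genOp x₀ hl (some (Sum.inr i))).coeffHom_mul
      (linGerm x₀ (l j.succ))).sub
    ((hasSymbol_genOp x₀ hl (some (Sum.inr j))).coeffHom_mul (linGerm x₀ (l i.succ)))
  rw [← map_sub, coeffHom_linGerm, coeffHom_linGerm] at h
  have h' := h.smul_op (l 0 (dualVec hl i))
  rw [opUTilde_eq]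
  convert h' using 1
  simp only [formSymbol, genSymbol, map_mul]
  ring

/-- The ideal generated by `Ẽ` and the `Ũ_{i,j}`. -/
def annIdeal : Ideal (DS (n + 1) x₀) :=
  Ideal.span ({opETilde x₀} ∪ {P | ∃ (i j : Fin (n + 1)) (hij : i < j), 0 < i ∧
    P = opUTilde hl x₀ hij.ne})

theorem annIdeal_le (hn : 0 < n) : annIdeal x₀ hl ≤ Ann l x₀ := by
  refine Ideal.span_le.2 ?_
  rintro P (rfl | ⟨i, j, hij, hi, rfl⟩)
  · exact mem_Ann_of_hasSymbol_zero x₀ hl hn (hasSymbol_genOp x₀ hl none)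
  · obtain ⟨i, rfl⟩ := Fin.exists_succ_eq.2 hi.ne'
    obtain ⟨j, rfl⟩ := Fin.exists_succ_eq.2 (hi.trans hij).ne'
    exact mem_Ann_of_hasSymbol_zero x₀ hl hn (hasSymbol_opUTilde x₀ hl _)

/-- The operators with symbols `y_j η_i - y_i η_j` are `Ũ_{i+1,j+1}` up to a nonzero scalar. -/
theorem sub_mem_annIdeal (i j : Fin n) :
    opLin (n + 1) x₀ (l j.succ) * genOp hl x₀ (some (Sum.inr i)) -
      opLin (n + 1) x₀ (l i.succ) * genOp hl x₀ (some (Sum.inr j)) ∈ annIdeal x₀ hl := by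
  have key : ∀ i j : Fin n, i < j → opLin (n + 1) x₀ (l j.succ) * genOp hl x₀ (some (Sum.inr i)) -
      opLin (n + 1) x₀ (l i.succ) * genOp hl x₀ (some (Sum.inr j)) ∈ annIdeal x₀ hl := by
    intro i j hij
    have h : opUTilde hl x₀ (Fin.succ_lt_succ_iff.2 hij).ne ∈ annIdeal x₀ hl :=
      Ideal.subset_span (Or.inr ⟨i.succ, j.succ, Fin.succ_lt_succ_iff.2 hij, Fin.succ_pos i, rfl⟩)
    rw [opUTilde_eq] at h
    have h2 := Ideal.mul_mem_left _ (algebraMap ℂ _ (l 0 (dualVec hl i))⁻¹) h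
    rwa [← Algebra.smul_def, inv_smul_smul₀ (zero_apply_dualVec_ne_zero hl i)] at h2
  rcases lt_trichotomy i j with h | rfl | h
  · exact key i j h
  · rw [sub_self]; exact zero_mem _
  · rw [← neg_sub]; exact neg_mem (key j i h)

/-- The kernel of the evaluation of symbols is generated by the symbols of the given operators;
for this the forms `l_1, …, l_n` have to be a regular sequence of germs at `x₀`. -/
theorem Ann_le (hn : 0 < n) : Ann l x₀ ≤ annIdeal x₀ hl := by
  refine le_of_symbols_mem_span (c := coeffHom (n + 1) x₀) (e := genOp hl x₀)
    (exists_genOp_mul_coeffHom hl x₀) (genOp_bracket_mem hl x₀) (exists_mem_ordFiltration hl x₀)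
    (S := {X none} ∪ {F | ∃ i j : Fin n, F = C (linGerm x₀ (l j.succ)) * X (some (Sum.inr i)) -
      C (linGerm x₀ (l i.succ)) * X (some (Sum.inr j))}) ?_ ?_ (annIdeal_le x₀ hl hn) ?_
  · rintro F (rfl | ⟨i, j, rfl⟩)
    · exact isHomogeneous_X _ _
    · exact (isHomogeneous_C_mul_X _ _).sub (isHomogeneous_C_mul_X _ _)
  · rintro F (rfl | ⟨i, j, rfl⟩)
    · have h := quantize_C_mul_X (c := coeffHom (n + 1) x₀) (e := genOp hl x₀) 1 none
      rw [C_1, one_mul, map_one, one_mul] at h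
      rw [h]
      exact Ideal.subset_span (Or.inl rfl)
    · rw [map_sub, quantize_C_mul_X, quantize_C_mul_X]
      exact sub_mem_annIdeal x₀ hl i j
  · intro P hP d F hF hPF
    refine mem_symbolIdeal_of_symbolHom_eq_zero (y := fun k => linGerm x₀ (l k.succ))
      (a := fun k => algebraMap ℂ _ (l 0 (dualVec hl k)))
      (yinv := fun k => invFactor (fun k => linGerm x₀ (l k)) k.succ)
      (Linv := invFactor (fun k => linGerm x₀ (l k)) 0) (L := linGerm x₀ (l 0))
      (algebraMap_powModule_injective x₀ hl hn)
      (fun k => mul_invFactor (fun k => linGerm x₀ (l k)) k.succ)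
      (mul_invFactor (fun k => linGerm x₀ (l k)) 0)
      (fun k b hb => mem_linIdeal_of_linGerm_mul_mem (y := fun k : Fin n => l k.succ)
        (apply_dualVec hl) k hb) ?_
    exact eval₂Hom_eq_zero_of_apply_eq_zero (ρ := actHom l x₀) (fun r => actHom_coeff x₀ (C r))
      (isHomogeneous_formSymbol x₀ hl) (hasSymbol_genOp x₀ hl) hF hP hPF

end Annihilator

end HyperplaneAnn

theorem mainTheorem4 (n : ℕ) (hn : 0 < n) (l : Fin (n + 1) → Module.Dual ℂ (Fin n → ℂ))
    (hl : HyperplaneAnn.Generic l) (x₀ : Fin n → ℂ) :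
    HyperplaneAnn.Ann l x₀ =
      Ideal.span ({HyperplaneAnn.opETilde x₀} ∪
        {P | ∃ (i j : Fin (n + 1)) (hij : i < j), 0 < i ∧
          P = HyperplaneAnn.opUTilde hl x₀ hij.ne}) :=
  le_antisymm (HyperplaneAnn.Ann_le x₀ hl hn) (HyperplaneAnn.annIdeal_le x₀ hl hn)
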